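/- **Setting.** For an irrational $\theta\in(0,1)$ let $\theta=[0;r_1,r_2,\dots]=\lim_n \cfrac{1}{r_1+\cfrac{1}{\cdots+\frac{1}{r_n}}}$ be its continued fraction expansion ($r_n\ge 1$), and put $q_0=1$, $q_1=r_1$, $q_{n+1}=r_{n+1}q_n+q_{n-1}$. Let $A_{\theta,0}=\mathbb C$, $A_{\theta,n}=M_{q_n}(\mathbb C)\oplus M_{q_{n-1}}(\mathbb C)$ for $n\ge1$, let $\alpha_{\theta,0}:\mathbb C\to A_{\theta,1}$ be the unital $*$-morphism, and for $n\ge 1$ let $\alpha_{\theta,n}:A_{\theta,n}\to A_{\theta,n+1}$, $a\oplus b\mapsto \mathrm{diag}(a,\dots,a,b)\oplus a$ with $r_{n+1}$ copies of $a$. The Effros–Shen algebra is the C*-inductive limit $AF_\theta=\varinjlim(A_{\theta,n},\alpha_{\theta,n})$; it has a unique tracial state $\sigma_\theta$, which is faithful. For $k\in(0,\infty)$ and self-adjoint $a\in AF_\theta$ let $$L_\theta^k(a)=\sup_{n\ge 0}\ (\dim A_{\theta,n})^k\,\|a-\mathbb E_n(a)\|\in[0,\infty],$$ where $\mathbb E_n$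 is the unique $\sigma_\theta$-preserving conditional expectation of $AF_\theta$ onto the canonical copy of $A_{\theta,n}$. A $(2,0)$-quasi-Leibniz quantum compact metric space is a pair $(\mathfrak A,L)$ of a nonzero unital C*-algebra and a lower semicontinuous seminorm $L$ on a dense Jordan–Lie subalgebra $\mathrm{dom}(L)$ of the self-adjoint part of $\mathfrak A$ (extended by $\infty$) such that $L(a)=0$ iff $a\in\mathbb R1$; $\max\{L(\frac{ab+ba}{2}),L(\frac{ab-ba}{2i})\}\le 2(\|a\|L(b)+\|b\|L(a))$ on $\mathrm{dom}(L)$; and $mk_L(\varphi,\psi)=\sup\{|\varphi(a)-\psi(a)|:L(a)\le1\}$ is a metric inducing the weak* topology on the state space $\mathscr S(\mathfrak A)$. A bridge from $(\mathfrak A,L_{\mathfrak A})$ to $(\mathfrak B,L_{\mathfrak B})$ consists of a unital C*-algebra $\mathfrak D$, unital $*$-monomorphisms $\pi:\mathfrak A\to\mathfrak D$ and $\rho:\mathfrak B\to\mathfrak D$, and $\omega\in\mathfrak D$ for which $\mathscr S_1=\{\varphi\in\mathscr S(\mathfrak D):\varphi(1-\omega^*\omega)=\varphi(1-\omega\omega^*)=0\}$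 is nonempty. Its length is the largest of: the $mk_{L_{\mathfrak A}}$-Hausdorff distance between $\mathscr S(\mathfrak A)$ and $\{\varphi\circ\pi:\varphi\in\mathscr S_1\}$; the $mk_{L_{\mathfrak B}}$-Hausdorff distance between $\mathscr S(\mathfrak B)$ and $\{\varphi\circ\rho:\varphi\in\mathscr S_1\}$; and the Hausdorff distance between the sets of self-adjoint $a\in\mathfrak A$ with $L_{\mathfrak A}(a)\le 1$ and self-adjoint $b\in\mathfrak B$ with $L_{\mathfrak B}(b)\le1$ for $\|\pi(a)\omega-\omega\rho(b)\|$. The quantum propinquity $\Lambda$ on the class of $(2,0)$-quasi-Leibniz quantum compact metric spaces is the largest pseudo-distance bounded above by the length of every bridge, i.e. the infimum, over all finite chains of bridges between such spaces joining the two given ones, of the sum of the lengths of the bridges. **Corollary.** Let $k\in(0,\infty)$, let $C,B:\mathbb N\to\mathbb N\setminus\{0\}$ be sequences, and let $$X=\{\theta\in(0,1)\setminus\mathbb Q:\ \theta=[0;r_1,r_2,\dots]\ \text{ with }\ C(n)\le r_n\le B(n)\ \text{ for all } n\ge 1\}.$$ Then for every $\theta\in X$ the pair $(AF_\theta,L_\theta^k)$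 is a $(2,0)$-quasi-Leibniz quantum compact metric space, and the set $\{(AF_\theta,L_\theta^k):\theta\in X\}$ is compact for the quantum propinquity $\Lambda$. -/

import Mathlib

open Filter Topology
open scoped ENNReal NNReal

noncomputable section

/-- An inductive sequence of unital C⋆-algebras with injective unital ⋆-morphisms. -/
structure CStarInductiveSequence where
  obj : ℕ → Type
  [cstarAlgebra : ∀ n, CStarAlgebra (obj n)]
  map : ∀ n, obj n →⋆ₐ[ℂ] obj (n + 1)
  map_injective : ∀ n, Function.Injective (map n)

namespace CStarInductiveSequence

attribute [instance] cstarAlgebra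

variable (S : CStarInductiveSequence)

/-- The composite `obj m → obj (m + 1) → ⋯ → obj n`. -/
def transition (m n : ℕ) (h : m ≤ n) : S.obj m →⋆ₐ[ℂ] S.obj n :=
  Nat.leRecOn h (fun {k} g => (S.map k).comp g) (StarAlgHom.id ℂ (S.obj m))

theorem transition_self (m : ℕ) : S.transition m m le_rfl = StarAlgHom.id ℂ (S.obj m) :=
  Nat.leRecOn_self _

theorem transition_succ {m n : ℕ} (h : m ≤ n) :
    S.transition m (n + 1) (h.trans n.le_succ) = (S.map n).comp (S.transition m n h) :=
  Nat.leRecOn_succ h _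

theorem transition_comp {l m n : ℕ} (h : l ≤ m) (h' : m ≤ n) :
    (S.transition m n h').comp (S.transition l m h) = S.transition l n (h.trans h') := by
  induction n, h' using Nat.le_induction with
  | base => rw [transition_self]; rfl
  | succ n h' ih => rw [transition_succ _ h', transition_succ _ (h.trans h'), ← ih]; rfl

theorem transition_injective {m n : ℕ} (h : m ≤ n) :
    Function.Injective (S.transition m n h) := by
  induction n, h using Nat.le_induction with
  | base => rw [transition_self]; exact Function.injective_id
  | succ n h ih =>
    rw [transition_succ _ h]
    exact (S.map_injective n).comp ih

instance : DirectedSystem S.obj (fun i j h => S.transition i j h) where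
  map_self i x := by rw [transition_self]; rfl
  map_map k j i h h' x := DFunLike.congr_fun (S.transition_comp h h') x

theorem norm_transition {m n : ℕ} (h : m ≤ n) (x : S.obj m) : ‖S.transition m n h x‖ = ‖x‖ :=
  NonUnitalStarAlgHom.norm_map (S.transition m n h) (S.transition_injective h) x

/-- The algebraic inductive limit, a pre-C⋆-algebra. -/
def PreLimit : Type := DirectLimit S.obj S.transition

namespace PreLimit

instance : Ring S.PreLimit := inferInstanceAs (Ring (DirectLimit S.obj S.transition))
instance : StarAddMonoid S.PreLimit :=
  inferInstanceAs (StarAddMonoid (DirectLimit S.obj S.transition))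
instance : StarMul S.PreLimit := inferInstanceAs (StarMul (DirectLimit S.obj S.transition))
instance : StarRing S.PreLimit where
  star_add := star_add
instance : Module ℂ S.PreLimit := inferInstanceAs (Module ℂ (DirectLimit S.obj S.transition))
instance : StarModule ℂ S.PreLimit :=
  inferInstanceAs (StarModule ℂ (DirectLimit S.obj S.transition))
instance : IsScalarTower ℂ S.PreLimit S.PreLimit :=
  inferInstanceAs (IsScalarTower ℂ (DirectLimit S.obj S.transition) (DirectLimit S.obj S.transition))
instance : SMulCommClass ℂ S.PreLimit S.PreLimit :=
  inferInstanceAs (SMulCommClass ℂ (DirectLimit S.obj S.transition) (DirectLimit S.obj S.transition))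
instance : Algebra ℂ S.PreLimit := Algebra.ofModule smul_mul_assoc mul_smul_comm

instance : Norm S.PreLimit where
  norm := DirectLimit.lift S.transition (fun _ x => ‖x‖) fun _ _ h x => (S.norm_transition h x).symm

/-- The canonical map of `obj n` into the algebraic inductive limit. -/
def of (n : ℕ) : S.obj n →⋆ₐ[ℂ] S.PreLimit where
  toFun x := (⟦⟨n, x⟩⟧ : DirectLimit S.obj S.transition)
  map_one' := (DirectLimit.one_def n).symm
  map_mul' x y := (DirectLimit.mul_def n x y).symm
  map_zero' := (DirectLimit.zero_def n).symm
  map_add' x y := (DirectLimit.add_def n x y).symm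
  map_star' _ := rfl
  commutes' r := by
    rw [Algebra.algebraMap_eq_smul_one, Algebra.algebraMap_eq_smul_one]
    change _ = r • (1 : DirectLimit S.obj S.transition)
    rw [DirectLimit.one_def n]
    rfl

theorem norm_of (n : ℕ) (x : S.obj n) : ‖of S n x‖ = ‖x‖ := rfl

theorem exists_of (z : S.PreLimit) : ∃ n x, z = of S n x :=
  DirectLimit.exists_eq_mk S.transition z

theorem exists_of₂ (z w : S.PreLimit) : ∃ n x y, z = of S n x ∧ w = of S n y :=
  DirectLimit.exists_eq_mk₂ S.transition z w

instance : NormedRing S.PreLimit :=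
  letI : NormedAddCommGroup S.PreLimit := AddGroupNorm.toNormedAddCommGroup
    { toFun := fun x => ‖x‖
      map_zero' := by rw [← map_zero (of S 0), norm_of, norm_zero]
      add_le' := fun z w => by
        obtain ⟨n, x, y, rfl, rfl⟩ := exists_of₂ S z w
        rw [← map_add, norm_of, norm_of, norm_of]
        exact norm_add_le x y
      neg' := fun z => by
        obtain ⟨n, x, rfl⟩ := exists_of S z
        rw [← map_neg, norm_of, norm_of, norm_neg]
      eq_zero_of_map_eq_zero' := fun z h => by
        obtain ⟨n, x, rfl⟩ := exists_of S z
        rw [norm_of, norm_eq_zero] at h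
        rw [h, map_zero] }
  { (inferInstance : Ring S.PreLimit), this with
    norm_mul_le := fun z w => by
      obtain ⟨n, x, y, rfl, rfl⟩ := exists_of₂ S z w
      rw [← map_mul]
      exact norm_mul_le x y }

instance : CStarRing S.PreLimit where
  norm_mul_self_le z := by
    obtain ⟨n, x, rfl⟩ := exists_of S z
    rw [← map_star, ← map_mul]
    exact CStarRing.norm_mul_self_le x

instance : NormedAlgebra ℂ S.PreLimit where
  norm_smul_le r z := by
    obtain ⟨n, x, rfl⟩ := exists_of S z
    rw [← map_smul]
    exact norm_smul_le r x

end PreLimit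

/-- The C⋆-inductive limit: the completion of the algebraic inductive limit. -/
def Limit : Type := UniformSpace.Completion S.PreLimit

namespace Limit

open UniformSpace

instance : NormedRing S.Limit := inferInstanceAs (NormedRing (Completion S.PreLimit))
instance : CompleteSpace S.Limit := inferInstanceAs (CompleteSpace (Completion S.PreLimit))
instance : NormedSpace ℂ S.Limit :=
  inferInstanceAs (NormedSpace ℂ (Completion S.PreLimit))
instance : Algebra ℂ S.Limit := inferInstanceAs (Algebra ℂ (Completion S.PreLimit))
instance : NormedAlgebra ℂ S.Limit where
  norm_smul_le := norm_smul_le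


/-- The isometric embedding of the algebraic inductive limit. -/
def incl (x : S.PreLimit) : S.Limit := (x : Completion S.PreLimit)

theorem norm_incl (x : S.PreLimit) : ‖incl S x‖ = ‖x‖ := Completion.norm_coe x
theorem incl_add (x y : S.PreLimit) : incl S (x + y) = incl S x + incl S y :=
  Completion.coe_add x y
theorem incl_mul (x y : S.PreLimit) : incl S (x * y) = incl S x * incl S y :=
  Completion.coe_mul x y
theorem incl_smul (c : ℂ) (x : S.PreLimit) : incl S (c • x) = c • incl S x :=
  Completion.coe_smul c x
theorem denseRange_incl : DenseRange (incl S) := Completion.denseRange_coe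
theorem continuous_incl : Continuous (incl S) := Completion.continuous_coe _

instance : Star S.Limit where
  star := (Completion.map star : Completion S.PreLimit → Completion S.PreLimit)

theorem continuous_star' : Continuous (star : S.Limit → S.Limit) := Completion.continuous_map

theorem incl_star (x : S.PreLimit) : incl S (star x) = star (incl S x) :=
  (Completion.map_coe (star_isometry (E := S.PreLimit)).uniformContinuous x).symm

instance : StarRing S.Limit where
  star_involutive x := by
    refine (denseRange_incl S).induction_on x
      (isClosed_eq ((continuous_star' S).comp (continuous_star' S)) continuous_id) fun a => ?_
    rw [← incl_star, ← incl_star, star_star]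
  star_mul x y := by
    refine (denseRange_incl S).induction_on₂ (p := fun x y => star (x * y) = star y * star x)
      (isClosed_eq ((continuous_star' S).comp continuous_mul)
        (((continuous_star' S).comp continuous_snd).mul ((continuous_star' S).comp continuous_fst)))
      (fun a b => ?_) x y
    rw [← incl_mul, ← incl_star, ← incl_star, ← incl_star, ← incl_mul, star_mul]
  star_add x y := by
    refine (denseRange_incl S).induction_on₂ (p := fun x y => star (x + y) = star x + star y)
      (isClosed_eq ((continuous_star' S).comp continuous_add)
        (((continuous_star' S).comp continuous_fst).add ((continuous_star' S).comp continuous_snd)))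
      (fun a b => ?_) x y
    rw [← incl_add, ← incl_star, ← incl_star, ← incl_star, ← incl_add, star_add]

instance : CStarAlgebra S.Limit where
  norm_mul_self_le x := by
    refine (denseRange_incl S).induction_on x
      (isClosed_le (continuous_norm.mul continuous_norm)
        (((continuous_star' S).mul continuous_id).norm)) fun a => ?_
    change ‖incl S a‖ * ‖incl S a‖ ≤ ‖star (incl S a) * incl S a‖
    rw [← incl_star, ← incl_mul, norm_incl, norm_incl]
    exact CStarRing.norm_mul_self_le a
  star_smul c x := by
    refine (denseRange_incl S).induction_on x
      (isClosed_eq ((continuous_star' S).comp (continuous_const_smul c))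
        ((continuous_star' S).const_smul (star c))) fun a => ?_
    rw [← incl_smul, ← incl_star, ← incl_star, ← incl_smul, star_smul]

/-- The canonical unital ⋆-morphism `obj n → Limit`. -/
def of (n : ℕ) : S.obj n →⋆ₐ[ℂ] S.Limit where
  toFun x := incl S (PreLimit.of S n x)
  map_one' := by rw [map_one]; rfl
  map_mul' x y := by rw [map_mul, incl_mul]
  map_zero' := by rw [map_zero]; rfl
  map_add' x y := by rw [map_add, incl_add]
  map_star' x := by rw [map_star, incl_star]
  commutes' r := by
    rw [Algebra.algebraMap_eq_smul_one, Algebra.algebraMap_eq_smul_one, map_smul, map_one,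
      incl_smul]
    rfl

/-- The canonical copy of `obj n` inside the inductive limit. -/
def stage (n : ℕ) : StarSubalgebra ℂ S.Limit := (of S n).range

end Limit
end CStarInductiveSequence

/-! ### States, Lip-norms, quasi-Leibniz quantum compact metric spaces -/

section QuantumMetric

open scoped ComplexOrder

/-- The state space of a unital C⋆-algebra; it carries the topology of `WeakDual ℂ A`,
i.e. the weak* topology. -/
def stateSpace (A : Type*) [CStarAlgebra A] : Set (WeakDual ℂ A) :=
  {φ | φ 1 = 1 ∧ ∀ a : A, 0 ≤ φ (star a * a)}

variable {A : Type*} [CStarAlgebra A]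

/-- The Jordan product `(ab + ba) / 2`. -/
def jordanProduct (a b : selfAdjoint A) : selfAdjoint A :=
  ⟨(1 / 2 : ℂ) • ((a : A) * b + b * a), by
    rw [selfAdjoint.mem_iff, star_smul, star_add, star_mul, star_mul,
      selfAdjoint.star_val_eq, selfAdjoint.star_val_eq, add_comm]
    congr 1
    simp⟩

/-- The Lie product `(ab - ba) / 2i`. -/
def lieProduct (a b : selfAdjoint A) : selfAdjoint A :=
  ⟨(1 / (2 * Complex.I) : ℂ) • ((a : A) * b - b * a), by
    rw [selfAdjoint.mem_iff, star_smul, star_sub, star_mul, star_mul,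
      selfAdjoint.star_val_eq, selfAdjoint.star_val_eq, ← neg_sub, smul_neg, ← neg_smul]
    congr 1
    simp⟩

/-- The (extended) Monge–Kantorovich metric of `L`. -/
def mongeKantorovich (L : selfAdjoint A → ℝ≥0∞) (φ ψ : WeakDual ℂ A) : ℝ≥0∞ :=
  ⨆ (a : selfAdjoint A) (_ : L a ≤ 1), ‖φ (a : A) - ψ (a : A)‖ₑ

/-- `(A, L)` is a `(C, D)`-quasi-Leibniz quantum compact metric space.  The seminorm `L` is extended
by `∞` outside its domain, so that the domain is `{a | L a < ∞}`. -/
structure IsQuantumCompactMetricSpace (C D : ℝ≥0) (L : selfAdjoint A → ℝ≥0∞) : Prop where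
  nontrivial : Nontrivial A
  map_add_le : ∀ a b, L (a + b) ≤ L a + L b
  map_smul : ∀ (t : ℝ) a, L (t • a) = ‖t‖ₑ * L a
  dense_domain : Dense {a | L a < ∞}
  eq_zero_iff : ∀ a, L a = 0 ↔ ∃ t : ℝ, (a : A) = algebraMap ℝ A t
  jordan_le : ∀ a b, L a < ∞ → L b < ∞ →
    L (jordanProduct a b) ≤ C * (‖(a : A)‖ₑ * L b + ‖(b : A)‖ₑ * L a) + D * L a * L b
  lie_le : ∀ a b, L a < ∞ → L b < ∞ →
    L (lieProduct a b) ≤ C * (‖(a : A)‖ₑ * L b + ‖(b : A)‖ₑ * L a) + D * L a * L b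
  /-- The Monge–Kantorovich metric is finite and induces the weak* topology on states. -/
  mongeKantorovich_lt_top : ∀ φ ∈ stateSpace A, ∀ ψ ∈ stateSpace A, mongeKantorovich L φ ψ < ∞
  nhdsWithin_hasBasis : ∀ φ ∈ stateSpace A, (𝓝[stateSpace A] φ).HasBasis
    (fun ε : ℝ≥0∞ => 0 < ε) fun ε => {ψ ∈ stateSpace A | mongeKantorovich L ψ φ < ε}
  lowerSemicontinuous : LowerSemicontinuous L

end QuantumMetric

/-- The class of `(C, D)`-quasi-Leibniz quantum compact metric spaces. -/
structure QuantumCompactMetricSpace (C D : ℝ≥0) where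
  carrier : Type
  [cstarAlgebra : CStarAlgebra carrier]
  lip : selfAdjoint carrier → ℝ≥0∞
  isQuantumCompactMetricSpace : IsQuantumCompactMetricSpace C D lip

attribute [instance] QuantumCompactMetricSpace.cstarAlgebra

/-! ### Bridges and the quantum propinquity -/

/-- The `1`-level set of `ω`. -/
def oneLevelSet {D : Type*} [CStarAlgebra D] (ω : D) : Set (WeakDual ℂ D) :=
  {φ ∈ stateSpace D | φ (1 - star ω * ω) = 0 ∧ φ (1 - ω * star ω) = 0}

/-- The dual map `φ ↦ φ ∘ π` of a unital ⋆-morphism. -/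
def dualMap {A D : Type*} [CStarAlgebra A] [CStarAlgebra D] (π : A →⋆ₐ[ℂ] D)
    (φ : WeakDual ℂ D) : WeakDual ℂ A :=
  StrongDual.toWeakDual
    ((WeakDual.toStrongDual φ).comp ⟨(π : A →ₗ[ℂ] D),
      AddMonoidHomClass.continuous_of_bound π 1 fun a => by
        simpa using NonUnitalStarAlgHom.norm_apply_le π a⟩)

theorem dualMap_apply {A D : Type*} [CStarAlgebra A] [CStarAlgebra D] (π : A →⋆ₐ[ℂ] D)
    (φ : WeakDual ℂ D) (a : A) : dualMap π φ a = φ (π a) := rfl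

/-- A bridge between two unital C⋆-algebras. -/
structure Bridge (A B : Type) [CStarAlgebra A] [CStarAlgebra B] where
  space : Type
  [cstarAlgebra : CStarAlgebra space]
  pivot : space
  left : A →⋆ₐ[ℂ] space
  right : B →⋆ₐ[ℂ] space
  left_injective : Function.Injective left
  right_injective : Function.Injective right
  oneLevelSet_nonempty : (oneLevelSet pivot).Nonempty

attribute [instance] Bridge.cstarAlgebra

/-- The Hausdorff distance between `S` and `T` where the distance between a point of `S`
and a point of `T` is measured by `d`. -/
def hausdorffDistance {X Y : Type*} (d : X → Y → ℝ≥0∞) (S : Set X) (T : Set Y) : ℝ≥0∞ :=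
  max (⨆ x ∈ S, ⨅ y ∈ T, d x y) (⨆ y ∈ T, ⨅ x ∈ S, d x y)

namespace Bridge

variable {A B : Type} [CStarAlgebra A] [CStarAlgebra B] (γ : Bridge A B)

/-- The bridge seminorm. -/
def seminorm (a : A) (b : B) : ℝ≥0∞ := ‖γ.left a * γ.pivot - γ.pivot * γ.right b‖ₑ

/-- The height of a bridge. -/
def height (LA : selfAdjoint A → ℝ≥0∞) (LB : selfAdjoint B → ℝ≥0∞) : ℝ≥0∞ :=
  max (hausdorffDistance (mongeKantorovich LA) (stateSpace A) (dualMap γ.left '' oneLevelSet γ.pivot))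
    (hausdorffDistance (mongeKantorovich LB) (stateSpace B)
      (dualMap γ.right '' oneLevelSet γ.pivot))

/-- The reach of a bridge. -/
def reach (LA : selfAdjoint A → ℝ≥0∞) (LB : selfAdjoint B → ℝ≥0∞) : ℝ≥0∞ :=
  hausdorffDistance (fun (a : selfAdjoint A) (b : selfAdjoint B) => γ.seminorm a b)
    {a | LA a ≤ 1} {b | LB b ≤ 1}

/-- The length of a bridge. -/
def length (LA : selfAdjoint A → ℝ≥0∞) (LB : selfAdjoint B → ℝ≥0∞) : ℝ≥0∞ :=
  max (γ.height LA LB) (γ.reach LA LB)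

/-- The bridge traversed backwards. -/
def symm : Bridge B A where
  space := γ.space
  pivot := star γ.pivot
  left := γ.right
  right := γ.left
  left_injective := γ.right_injective
  right_injective := γ.left_injective
  oneLevelSet_nonempty := by
    obtain ⟨φ, h, h₁, h₂⟩ := γ.oneLevelSet_nonempty
    exact ⟨φ, h, by rwa [star_star], by rwa [star_star]⟩

theorem length_symm (LA : selfAdjoint A → ℝ≥0∞) (LB : selfAdjoint B → ℝ≥0∞) :
    γ.symm.length LB LA = γ.length LA LB := by
  have h : oneLevelSet γ.symm.pivot = oneLevelSet γ.pivot := by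
    ext φ
    have : oneLevelSet (star γ.pivot) = oneLevelSet γ.pivot := by
      ext φ
      unfold oneLevelSet
      rw [Set.mem_ofPred_eq, Set.mem_ofPred_eq, star_star,
        and_comm (a := φ (1 - γ.pivot * star γ.pivot) = 0)]
    exact Set.ext_iff.1 this φ
  have h' : γ.symm.height LB LA = γ.height LA LB := by
    unfold height
    rw [h, max_comm]
    rfl
  have h'' (a : selfAdjoint A) (b : selfAdjoint B) : γ.symm.seminorm b a = γ.seminorm a b := by
    have : star (γ.right b * star γ.pivot - star γ.pivot * γ.left a) =
        -(γ.left a * γ.pivot - γ.pivot * γ.right b) := by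
      rw [star_sub, star_mul, star_mul, star_star, ← map_star, ← map_star,
        selfAdjoint.star_val_eq, selfAdjoint.star_val_eq, neg_sub]
    change ‖γ.right b * star γ.pivot - star γ.pivot * γ.left a‖ₑ =
      ‖γ.left a * γ.pivot - γ.pivot * γ.right b‖ₑ
    rw [← enorm_neg (γ.left a * γ.pivot - _), ← this, ← ofReal_norm, ← ofReal_norm, norm_star]
  unfold length reach hausdorffDistance
  rw [h', max_comm (⨆ x ∈ {b | LB b ≤ 1}, _)]
  simp only [h'']

end Bridge

variable {C D : ℝ≥0}

/-- A trek: a finite path of bridges through quantum compact metric spaces.  The empty trek plays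
the role of the identity bridge, whose length is `0`. -/
inductive Trek : QuantumCompactMetricSpace C D → QuantumCompactMetricSpace C D → Type 1
  | nil (X : QuantumCompactMetricSpace C D) : Trek X X
  | cons {X Y Z : QuantumCompactMetricSpace C D} (γ : Bridge X.carrier Y.carrier) (t : Trek Y Z) :
      Trek X Z

/-- The length of a trek is the sum of the lengths of its bridges. -/
def Trek.length : {X Y : QuantumCompactMetricSpace C D} → Trek X Y → ℝ≥0∞
  | _, _, .nil _ => 0
  | _, _, .cons (X := X) (Y := Y) γ t => γ.length X.lip Y.lip + t.length

/-- The quantum Gromov–Hausdorff propinquity on `(C, D)`-quasi-Leibniz quantum compact metric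
spaces: the infimum of the lengths of the treks, i.e. the largest pseudo-distance which is bounded
above by the length of every bridge. -/
def quantumPropinquity (X Y : QuantumCompactMetricSpace C D) : ℝ≥0∞ :=
  ⨅ t : Trek X Y, t.length

theorem quantumPropinquity_le_length_add {X Y Z : QuantumCompactMetricSpace C D}
    (γ : Bridge X.carrier Y.carrier) :
    quantumPropinquity X Z ≤ γ.length X.lip Y.lip + quantumPropinquity Y Z := by
  unfold quantumPropinquity
  rw [ENNReal.add_iInf]
  exact le_iInf fun t => iInf_le (fun t : Trek X Z => t.length) (.cons γ t)

theorem quantumPropinquity_self (X : QuantumCompactMetricSpace C D) :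
    quantumPropinquity X X = 0 :=
  nonpos_iff_eq_zero.1 (iInf_le (fun t : Trek X X => t.length) (.nil X))

theorem quantumPropinquity_triangle (X Y Z : QuantumCompactMetricSpace C D) :
    quantumPropinquity X Z ≤ quantumPropinquity X Y + quantumPropinquity Y Z := by
  conv_rhs => rw [quantumPropinquity, ENNReal.iInf_add]
  refine le_iInf fun t => ?_
  induction t with
  | nil X => exact le_add_self
  | cons γ t ih =>
    rw [Trek.length, add_assoc]
    exact (quantumPropinquity_le_length_add γ).trans (add_le_add le_rfl ih)

theorem quantumPropinquity_le_length {X Y : QuantumCompactMetricSpace C D}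
    (γ : Bridge X.carrier Y.carrier) : quantumPropinquity X Y ≤ γ.length X.lip Y.lip := by
  simpa only [quantumPropinquity_self, add_zero] using
    quantumPropinquity_le_length_add (Z := Y) γ

theorem quantumPropinquity_le_comm (X Y : QuantumCompactMetricSpace C D) :
    quantumPropinquity Y X ≤ quantumPropinquity X Y := by
  refine le_iInf fun t => ?_
  induction t with
  | nil X => exact (quantumPropinquity_self X).le
  | @cons X Y Z γ t ih =>
    rw [Trek.length, add_comm, ← γ.length_symm]
    exact (quantumPropinquity_triangle Z Y X).trans
      (add_le_add ih (quantumPropinquity_le_length γ.symm))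

/-- The topology on the class of quantum compact metric spaces is that of the
quantum propinquity. -/
instance : PseudoEMetricSpace (QuantumCompactMetricSpace C D) where
  edist := quantumPropinquity
  edist_self := quantumPropinquity_self
  edist_comm X Y := le_antisymm (quantumPropinquity_le_comm Y X) (quantumPropinquity_le_comm X Y)
  edist_triangle := quantumPropinquity_triangle

/-! ### The Lip-norms of an inductive sequence -/

section ConditionalExpectation

variable {A : Type*} [CStarAlgebra A]

/-- `τ` is a tracial state. -/
def IsTracialState (τ : WeakDual ℂ A) : Prop :=
  τ ∈ stateSpace A ∧ ∀ a b, τ (a * b) = τ (b * a)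

/-- `E` is a conditional expectation of `A` onto the C⋆-subalgebra `B`. -/
structure IsConditionalExpectation (B : StarSubalgebra ℂ A) (E : A →L[ℂ] A) : Prop where
  mem : ∀ a, E a ∈ B
  apply_of_mem : ∀ b ∈ B, E b = b
  map_nonneg : ∀ a, ∃ b, E (star a * a) = star b * b
  norm_eq_one : ‖E‖ = 1
  map_mul_mul : ∀ b ∈ B, ∀ c ∈ B, ∀ a, E (b * a * c) = b * E a * c

/-- The conditional expectation onto `B` which preserves `μ` (it is unique when `μ` is a
faithful tracial state and `B` is finite dimensional). -/
def condExpectation (B : StarSubalgebra ℂ A) (μ : WeakDual ℂ A) : A →L[ℂ] A :=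
  Classical.epsilon fun E => IsConditionalExpectation B E ∧ ∀ a, μ (E a) = μ a

end ConditionalExpectation

namespace CStarInductiveSequence

variable (S : CStarInductiveSequence)

/-- The seminorm `a ↦ sup_n ‖a - E_n(a)‖ / β(n)`, where `E_n` is the `μ`-preserving conditional
expectation onto the canonical copy of the `n`-th algebra of the sequence. -/
def lipNorm (μ : WeakDual ℂ S.Limit) (β : ℕ → ℝ) (a : selfAdjoint S.Limit) : ℝ≥0∞ :=
  ⨆ n, ENNReal.ofReal
    (‖(a : S.Limit) - condExpectation (Limit.stage S n) μ (a : S.Limit)‖ / β n)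

/-- The sequence `n ↦ 1 / (dim obj n) ^ k`. -/
def dimWeight (k : ℝ) (n : ℕ) : ℝ := 1 / (Module.finrank ℂ (S.obj n) : ℝ) ^ k

end CStarInductiveSequence

/-! ### The Effros–Shen algebras -/

/-- The continued fraction digits `r_0, r_1, r_2, …` of a real number, `θ = [r_0; r_1, r_2, …]`
(for `θ ≥ 0` irrational all digits exist). -/
def cfDigit (θ : ℝ) : ℕ → ℕ
  | 0 => ⌊θ⌋₊
  | n + 1 => ⌊((GenContFract.of θ).partDens.get? n).getD 0⌋₊

namespace EffrosShen

open scoped Matrix.Norms.L2Operator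

/-- The denominators `q_n`: `q_0 = 1`, `q_1 = r_1`, `q_{n+1} = r_{n+1} q_n + q_{n-1}`. -/
def q (r : ℕ → ℕ) : ℕ → ℕ
  | 0 => 1
  | 1 => r 1
  | n + 2 => r (n + 2) * q r (n + 1) + q r n

/-- `ℂ` for `n = 0`, and `M(q_n) ⊕ M(q_{n-1})` for `n ≥ 1`. -/
def Stage (r : ℕ → ℕ) : ℕ → Type
  | 0 => ℂ
  | n + 1 => Matrix (Fin (q r (n + 1))) (Fin (q r (n + 1))) ℂ × Matrix (Fin (q r n)) (Fin (q r n)) ℂ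

instance (r : ℕ → ℕ) : (n : ℕ) → CStarAlgebra (Stage r n)
  | 0 => inferInstanceAs (CStarAlgebra ℂ)
  | n + 1 => inferInstanceAs (CStarAlgebra
      (Matrix (Fin (q r (n + 1))) (Fin (q r (n + 1))) ℂ × Matrix (Fin (q r n)) (Fin (q r n)) ℂ))

/-- The position in `Fin (m * p + s)` of the `i`-th index of the `j`-th copy of `Fin p`,
respectively of an index of the last block `Fin s`. -/
def blockEquiv (m p s : ℕ) : (Fin p × Fin m) ⊕ Fin s ≃ Fin (m * p + s) :=
  (Equiv.sumCongr ((Equiv.prodComm _ _).trans finProdFinEquiv) (Equiv.refl _)).trans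
    finSumFinEquiv

/-- The block diagonal matrix `diag(a, …, a, b)` with `m` copies of `a`. -/
def blockMatrix (m : ℕ) {p s : ℕ} (a : Matrix (Fin p) (Fin p) ℂ) (b : Matrix (Fin s) (Fin s) ℂ) :
    Matrix (Fin (m * p + s)) (Fin (m * p + s)) ℂ :=
  Matrix.reindexAlgEquiv ℂ ℂ (blockEquiv m p s)
    (Matrix.fromBlocks (Matrix.blockDiagonal fun _ : Fin m => a) 0 0 b)

/-- The morphism `a ⊕ b ↦ diag(a, …, a, b) ⊕ a`, with `m` copies of `a`. -/
def blockHom (m p s : ℕ) :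
    (Matrix (Fin p) (Fin p) ℂ × Matrix (Fin s) (Fin s) ℂ) →⋆ₐ[ℂ]
      (Matrix (Fin (m * p + s)) (Fin (m * p + s)) ℂ × Matrix (Fin p) (Fin p) ℂ) where
  toFun x := (blockMatrix m x.1 x.2, x.1)
  map_one' := by
    refine Prod.ext ?_ rfl
    change Matrix.reindexAlgEquiv ℂ ℂ (blockEquiv m p s) (Matrix.fromBlocks
      (Matrix.blockDiagonal (1 : Fin m → Matrix (Fin p) (Fin p) ℂ)) 0 0 1) = 1
    rw [Matrix.blockDiagonal_one, Matrix.fromBlocks_one, map_one]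
  map_mul' x y := by
    refine Prod.ext ?_ rfl
    change blockMatrix m (x.1 * y.1) (x.2 * y.2) = blockMatrix m x.1 x.2 * blockMatrix m y.1 y.2
    unfold blockMatrix
    rw [← map_mul, Matrix.fromBlocks_multiply, Matrix.blockDiagonal_mul]
    simp only [Matrix.mul_zero, Matrix.zero_mul, add_zero, zero_add]
  map_zero' := by
    refine Prod.ext ?_ rfl
    change Matrix.reindexAlgEquiv ℂ ℂ (blockEquiv m p s) (Matrix.fromBlocks
      (Matrix.blockDiagonal (0 : Fin m → Matrix (Fin p) (Fin p) ℂ)) 0 0 0) = 0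
    rw [Matrix.blockDiagonal_zero, Matrix.fromBlocks_zero, map_zero]
  map_add' x y := by
    refine Prod.ext ?_ rfl
    change blockMatrix m (x.1 + y.1) (x.2 + y.2) = blockMatrix m x.1 x.2 + blockMatrix m y.1 y.2
    unfold blockMatrix
    rw [← map_add, Matrix.fromBlocks_add, ← Matrix.blockDiagonal_add]
    simp only [add_zero]
    rfl
  commutes' c := by
    refine Prod.ext ?_ rfl
    change blockMatrix m (algebraMap ℂ _ c) (algebraMap ℂ _ c) = algebraMap ℂ _ c
    have h : Matrix.fromBlocks
        (Matrix.blockDiagonal fun _ : Fin m => algebraMap ℂ (Matrix (Fin p) (Fin p) ℂ) c) 0 0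
        (algebraMap ℂ (Matrix (Fin s) (Fin s) ℂ) c) = algebraMap ℂ _ c := by
      simp only [Algebra.algebraMap_eq_smul_one]
      rw [← Matrix.fromBlocks_one, Matrix.fromBlocks_smul, smul_zero, smul_zero,
        ← Matrix.blockDiagonal_one, ← Matrix.blockDiagonal_smul]
      rfl
    unfold blockMatrix
    rw [h, AlgEquiv.commutes]
  map_star' x := by
    refine Prod.ext ?_ rfl
    change blockMatrix m x.1.conjTranspose x.2.conjTranspose =
      (blockMatrix m x.1 x.2).conjTranspose
    unfold blockMatrix
    rw [Matrix.coe_reindexAlgEquiv, Matrix.conjTranspose_reindex,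
      Matrix.fromBlocks_conjTranspose, Matrix.blockDiagonal_conjTranspose]
    simp only [Matrix.conjTranspose_zero]

theorem blockHom_injective (m p s : ℕ) : Function.Injective (blockHom m p s) := by
  intro x y h
  obtain ⟨h₁, h₂⟩ := Prod.ext_iff.1 h
  refine Prod.ext h₂ ?_
  exact (Matrix.fromBlocks_inj.1 ((Matrix.reindexAlgEquiv ℂ ℂ (blockEquiv m p s)).injective h₁)).2.2.2

/-- The inductive sequence defining the Effros–Shen algebra with digits `r`. -/
def sequence (r : ℕ → ℕ) : CStarInductiveSequence where
  obj := Stage r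
  map
    | 0 => StarAlgHom.ofId ℂ (Stage r 1)
    | n + 1 => blockHom (r (n + 2)) (q r (n + 1)) (q r n)
  map_injective
    | 0 => by
      have : Nontrivial (Matrix (Fin (q r 0)) (Fin (q r 0)) ℂ) :=
        inferInstanceAs (Nontrivial (Matrix (Fin 1) (Fin 1) ℂ))
      have : Nontrivial (Stage r 1) := inferInstanceAs (Nontrivial
        (Matrix (Fin (q r 1)) (Fin (q r 1)) ℂ × Matrix (Fin (q r 0)) (Fin (q r 0)) ℂ))
      exact (algebraMap ℂ (Stage r 1)).injective
    | n + 1 => blockHom_injective (r (n + 2)) (q r (n + 1)) (q r n)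

end EffrosShen

/-- The Effros–Shen algebra `AF_θ`. -/
def EffrosShenAlgebra (θ : ℝ) : Type := (EffrosShen.sequence (cfDigit θ)).Limit

instance (θ : ℝ) : CStarAlgebra (EffrosShenAlgebra θ) :=
  inferInstanceAs (CStarAlgebra (EffrosShen.sequence (cfDigit θ)).Limit)

/-- The tracial state `σ_θ` of `AF_θ` (it is unique, and faithful, for irrational `θ` in `(0, 1)`). -/
def effrosShenTrace (θ : ℝ) : WeakDual ℂ (EffrosShenAlgebra θ) :=
  Classical.epsilon IsTracialState

/-- The Lip-norm `L_θ^k` on `AF_θ`. -/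
def effrosShenLipNorm (k θ : ℝ) : selfAdjoint (EffrosShenAlgebra θ) → ℝ≥0∞ :=
  (EffrosShen.sequence (cfDigit θ)).lipNorm (effrosShenTrace θ)
    ((EffrosShen.sequence (cfDigit θ)).dimWeight k)

/-- The irrational numbers `θ = [0; r_1, r_2, …]` in `(0, 1)` with
`C(n) ≤ r_n ≤ B(n)` for all `n ≥ 1`. -/
def boundedDigits (C B : ℕ → ℕ+) : Set ℝ :=
  {θ | Irrational θ ∧ θ ∈ Set.Ioo 0 1 ∧
    ∀ n, 1 ≤ n → (C n : ℕ) ≤ cfDigit θ n ∧ cfDigit θ n ≤ B n}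

end

/-! The space attached to `θ` depends only on the digit sequence `cfDigit θ`, and the admissible
digit sequences form a product of finite sets, compact in `ℕ → ℕ` by Tychonoff. Every such sequence
is the digit sequence of some irrational in (0, 1) (`exists_mem_Ioo_cfDigit_eq`). So compactness
follows once the map from digits to spaces is continuous for the propinquity
(`EffrosShen.continuous_space`), as a continuous image of a compact set.

For continuity, let `r` and `r'` agree up to a large index and cross between the limits by three
bridges. A limit is within `β (M + 1)` of its stage `M + 1`, since the expectation onto that stage
moves the Lip ball by at most this weight and does not increase the seminorm
(`exists_bridge_length_le_of_intertwining`). The two stages are the same matrix algebra with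
different seminorms, because the expectations depend on the traces. Close traces give close
expectations (`IsRestriction.norm_sub_le`), and close expectations give a short bridge
(`exists_bridge_length_le_of_perturbation`).

The traces are close because a tracial state is encoded by weights with `x n = r (n + 1) * x (n + 1)
+ x (n + 2)` and `x 0 = 1`. While the digits agree, the difference of two such sequences is a fixed
multiple of `(-1) ^ n * q r n`. It stays bounded by 1 although `q` grows, so the multiple is small
(`IsTraceWeight.abs_sub_le`). The estimate holds for any tracial states, so no separate uniqueness
theorem is needed.

That each pair is a quantum compact metric space is proved for an abstract tower of expectations:
the quasi-Leibniz constant 2 comes from `‖1 - E n‖ ≤ 2`, and the weak* topology from approximating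
the Lip ball, modulo scalars, by compact subsets of the finite-dimensional ranges. -/

section States

/-! ### Elementary facts on states -/

open scoped ComplexOrder

variable {A : Type*} [CStarAlgebra A]

/-- This is -‖a‖ ≤ a ≤ ‖a‖ in the spectral order, unpacked into squares because positivity of states
is phrased on `star a * a`. -/
theorem exists_star_mul_self_norm_sub {a : A} (ha : IsSelfAdjoint a) :
    (∃ b, algebraMap ℝ A ‖a‖ - a = star b * b) ∧ ∃ b, algebraMap ℝ A ‖a‖ + a = star b * b := by
  let _ := CStarAlgebra.spectralOrder A
  have := CStarAlgebra.spectralOrderedRing A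
  refine ⟨CStarAlgebra.nonneg_iff_eq_star_mul_self.1 (sub_nonneg.2 ha.le_algebraMap_norm_self),
    CStarAlgebra.nonneg_iff_eq_star_mul_self.1 ?_⟩
  have := sub_nonneg.2 ha.neg_algebraMap_norm_le_self
  rwa [sub_neg_eq_add, add_comm] at this

theorem apply_algebraMap_of_mem_stateSpace {φ : WeakDual ℂ A} (hφ : φ ∈ stateSpace A) (c : ℂ) :
    φ (algebraMap ℂ A c) = c := by
  rw [Algebra.algebraMap_eq_smul_one, map_smul, hφ.1, smul_eq_mul, mul_one]

/-- Reality of `φ` on the square of `1 + y` forces `φ y + φ (star y)` to be real; the cases `y = a`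
and `y = I • a` give both coordinates. -/
theorem apply_star_of_mem_stateSpace {φ : WeakDual ℂ A} (hφ : φ ∈ stateSpace A) (a : A) :
    φ (star a) = star (φ a) := by
  have him (x : A) : (φ (star x * x)).im = 0 := ((Complex.nonneg_iff.1 (hφ.2 x)).2).symm
  have key (y : A) : (φ y + φ (star y)).im = 0 := by
    have h := him (1 + y)
    have e : star (1 + y) * (1 + y) = star (1 : A) * 1 + y + star y + star y * y := by
      simp only [star_add, star_one]
      noncomm_ring
    rw [e, map_add, map_add, map_add, Complex.add_im, Complex.add_im, Complex.add_im, him, him] at h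
    rw [Complex.add_im]
    linarith
  have h₁ := key a
  have h₂ := key (Complex.I • a)
  rw [star_smul, map_smul, map_smul] at h₂
  simp only [smul_eq_mul, Complex.add_im, Complex.mul_im, Complex.I_re, Complex.I_im, zero_mul,
    one_mul, Complex.star_def, Complex.conj_I, Complex.neg_re, Complex.neg_im] at h₁ h₂
  apply Complex.ext
  · rw [Complex.star_def, Complex.conj_re]
    linarith
  · rw [Complex.star_def, Complex.conj_im]
    linarith

theorem norm_apply_le_of_mem_stateSpace {φ : WeakDual ℂ A} (hφ : φ ∈ stateSpace A) {a : A}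
    (ha : IsSelfAdjoint a) : ‖φ a‖ ≤ ‖a‖ := by
  obtain ⟨⟨b, hb⟩, ⟨c, hc⟩⟩ := exists_star_mul_self_norm_sub ha
  have hn : φ (algebraMap ℝ A ‖a‖) = (‖a‖ : ℂ) := by
    rw [IsScalarTower.algebraMap_apply ℝ ℂ A, apply_algebraMap_of_mem_stateSpace hφ]
    rfl
  have h₁ := hφ.2 b
  have h₂ := hφ.2 c
  rw [← hb, map_sub, hn, Complex.nonneg_iff] at h₁
  rw [← hc, map_add, hn, Complex.nonneg_iff] at h₂
  simp only [Complex.sub_re, Complex.add_re, Complex.ofReal_re, Complex.sub_im,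
    Complex.ofReal_im] at h₁ h₂
  have him : (φ a).im = 0 := by linarith [h₁.2]
  rw [← Complex.re_add_im (φ a), him]
  simp only [Complex.ofReal_zero, zero_mul, add_zero, Complex.norm_real, Real.norm_eq_abs]
  exact abs_le.2 ⟨by linarith [h₂.1], by linarith [h₁.1]⟩

end States

/-! ### Towers of expectations and their seminorms -/

/-- A sequence of maps which behaves like the conditional expectations onto an increasing
sequence of finite-dimensional C⋆-subalgebras with dense union, the first one being `ℂ1`. -/
structure IsExpectationTower {A : Type*} [CStarAlgebra A] (E : ℕ → A →L[ℂ] A) : Prop where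
  norm_le : ∀ n a, ‖E n a‖ ≤ ‖a‖
  map_star : ∀ n a, E n (star a) = star (E n a)
  map_one : ∀ n, E n 1 = 1
  map_mul : ∀ n a b, E n (E n a * E n b) = E n a * E n b
  apply_apply_of_le : ∀ {m n}, m ≤ n → ∀ a, E m (E n a) = E m a
  apply_apply_of_ge : ∀ {m n}, m ≤ n → ∀ a, E n (E m a) = E m a
  scalar : ∀ a, ∃ c : ℂ, E 0 a = algebraMap ℂ A c
  finiteDimensional : ∀ n, FiniteDimensional ℂ (E n).range
  tendsto : ∀ a, Tendsto (fun n => E n a) atTop (𝓝 a)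

section TowerSeminorm

variable {A : Type*} [CStarAlgebra A]

/-- The seminorm `a ↦ sup_n ‖a - E_n(a)‖ / β(n)`. -/
noncomputable def towerSeminorm (E : ℕ → A →L[ℂ] A) (β : ℕ → ℝ) (a : selfAdjoint A) : ℝ≥0∞ :=
  ⨆ n, ENNReal.ofReal (‖(a : A) - E n (a : A)‖ / β n)

variable {E : ℕ → A →L[ℂ] A} {β : ℕ → ℝ}

theorem towerSeminorm_le_ofReal_iff (hβ : ∀ n, 0 < β n) {c : ℝ} (hc : 0 ≤ c) {a : selfAdjoint A} :
    towerSeminorm E β a ≤ ENNReal.ofReal c ↔ ∀ n, ‖(a : A) - E n (a : A)‖ ≤ c * β n := by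
  rw [towerSeminorm, iSup_le_iff]
  refine forall_congr' fun n => ?_
  rw [ENNReal.ofReal_le_ofReal_iff hc, div_le_iff₀ (hβ n)]

theorem towerSeminorm_le_one_iff (hβ : ∀ n, 0 < β n) {a : selfAdjoint A} :
    towerSeminorm E β a ≤ 1 ↔ ∀ n, ‖(a : A) - E n (a : A)‖ ≤ β n := by
  rw [← ENNReal.ofReal_one, towerSeminorm_le_ofReal_iff hβ zero_le_one]
  simp only [one_mul]

theorem towerSeminorm_add_le (hβ : ∀ n, 0 < β n) (a b : selfAdjoint A) :
    towerSeminorm E β (a + b) ≤ towerSeminorm E β a + towerSeminorm E β b := by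
  refine iSup_le fun n => ?_
  refine le_trans ?_ (add_le_add (le_iSup (fun n => ENNReal.ofReal
    (‖(a : A) - E n (a : A)‖ / β n)) n) (le_iSup (fun n => ENNReal.ofReal
    (‖(b : A) - E n (b : A)‖ / β n)) n))
  rw [← ENNReal.ofReal_add (div_nonneg (norm_nonneg _) (hβ n).le)
    (div_nonneg (norm_nonneg _) (hβ n).le), ← add_div]
  refine ENNReal.ofReal_le_ofReal (div_le_div_of_nonneg_right ?_ (hβ n).le)
  rw [AddSubgroup.coe_add, map_add, add_sub_add_comm]
  exact norm_add_le _ _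

theorem towerSeminorm_smul (t : ℝ) (a : selfAdjoint A) :
    towerSeminorm E β (t • a) = ‖t‖ₑ * towerSeminorm E β a := by
  rw [towerSeminorm, towerSeminorm, ENNReal.mul_iSup]
  refine iSup_congr fun n => ?_
  rw [← ofReal_norm, ← ENNReal.ofReal_mul (norm_nonneg t), selfAdjoint.val_smul]
  have : E n (t • (a : A)) = t • E n (a : A) := map_real_smul (E n) (E n).continuous t _
  rw [this, ← smul_sub, norm_smul, mul_div_assoc]

theorem lowerSemicontinuous_towerSeminorm : LowerSemicontinuous (towerSeminorm E β) := by
  refine lowerSemicontinuous_iSup fun n => Continuous.lowerSemicontinuous ?_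
  refine ENNReal.continuous_ofReal.comp ?_
  exact ((continuous_subtype_val.sub ((E n).continuous.comp continuous_subtype_val)).norm).div_const _

end TowerSeminorm

namespace IsExpectationTower

variable {A : Type*} [CStarAlgebra A] {E : ℕ → A →L[ℂ] A} {β : ℕ → ℝ}

theorem apply_algebraMap (hE : IsExpectationTower E) (n : ℕ) (c : ℂ) :
    E n (algebraMap ℂ A c) = algebraMap ℂ A c := by
  rw [Algebra.algebraMap_eq_smul_one, _root_.map_smul, hE.map_one]

/-- The product `E n a * E n b` is fixed by `E n`, so subtracting it from `a * b` does not change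
the defect. Applying `1 - E n`, of norm at most 2, then costs the factor 2. -/
theorem norm_mul_sub_le (hE : IsExpectationTower E) (n : ℕ) (a b : A) :
    ‖a * b - E n (a * b)‖ ≤ 2 * (‖a‖ * ‖b - E n b‖ + ‖b‖ * ‖a - E n a‖) := by
  have h₁ : ‖a * b - E n a * E n b‖ ≤ ‖a‖ * ‖b - E n b‖ + ‖b‖ * ‖a - E n a‖ := by
    have e : a * b - E n a * E n b = (a - E n a) * b + E n a * (b - E n b) := by noncomm_ring
    rw [e]
    calc _ ≤ ‖a - E n a‖ * ‖b‖ + ‖E n a‖ * ‖b - E n b‖ :=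
          (norm_add_le _ _).trans (add_le_add (norm_mul_le _ _) (norm_mul_le _ _))
      _ ≤ ‖a - E n a‖ * ‖b‖ + ‖a‖ * ‖b - E n b‖ := by
          gcongr
          exact hE.norm_le n a
      _ = _ := by ring
  have e : a * b - E n (a * b) =
      (a * b - E n a * E n b) - E n (a * b - E n a * E n b) := by
    rw [map_sub, hE.map_mul]
    abel
  rw [e]
  calc _ ≤ ‖a * b - E n a * E n b‖ + ‖E n (a * b - E n a * E n b)‖ := norm_sub_le _ _
    _ ≤ ‖a * b - E n a * E n b‖ + ‖a * b - E n a * E n b‖ := by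
        gcongr
        exact hE.norm_le n _
    _ ≤ _ := by linarith

/-- Treats the Jordan and Lie products together: both are `c • ab + d • ba` with `‖c‖ + ‖d‖ = 1`. -/
theorem norm_smul_mul_add_smul_mul_sub_le (hE : IsExpectationTower E) (hβ : ∀ n, 0 < β n) (n : ℕ)
    (c d : ℂ) (hcd : ‖c‖ + ‖d‖ ≤ 1) (a b : selfAdjoint A) :
    ENNReal.ofReal (‖(c • ((a : A) * b) + d • ((b : A) * a)) -
        E n (c • ((a : A) * b) + d • ((b : A) * a))‖ / β n) ≤
      2 * (‖(a : A)‖ₑ * towerSeminorm E β b + ‖(b : A)‖ₑ * towerSeminorm E β a) := by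
  have hβ' := (hβ n).le
  set X := ‖(a : A)‖ * ‖(b : A) - E n b‖ + ‖(b : A)‖ * ‖(a : A) - E n a‖ with hX
  have hX0 : 0 ≤ X := by positivity
  have h₁ := hE.norm_mul_sub_le n (a : A) b
  have h₂ := hE.norm_mul_sub_le n (b : A) a
  rw [add_comm (‖(b : A)‖ * _)] at h₂
  have h : ‖(c • ((a : A) * b) + d • ((b : A) * a)) -
        E n (c • ((a : A) * b) + d • ((b : A) * a))‖ ≤ 2 * X := by
    rw [map_add, _root_.map_smul, _root_.map_smul, add_sub_add_comm, ← smul_sub, ← smul_sub]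
    calc _ ≤ ‖c‖ * (2 * X) + ‖d‖ * (2 * X) := by
          refine (norm_add_le _ _).trans ?_
          rw [norm_smul, norm_smul]
          gcongr
      _ = (‖c‖ + ‖d‖) * (2 * X) := by ring
      _ ≤ 1 * (2 * X) := by gcongr
      _ = _ := one_mul _
  calc _ ≤ ENNReal.ofReal (2 * (‖(a : A)‖ * (‖(b : A) - E n b‖ / β n) +
          ‖(b : A)‖ * (‖(a : A) - E n a‖ / β n))) := by
        refine ENNReal.ofReal_le_ofReal ((div_le_div_of_nonneg_right h hβ').trans_eq ?_)
        rw [hX]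
        ring
    _ = 2 * (‖(a : A)‖ₑ * ENNReal.ofReal (‖(b : A) - E n b‖ / β n) +
          ‖(b : A)‖ₑ * ENNReal.ofReal (‖(a : A) - E n a‖ / β n)) := by
        rw [ENNReal.ofReal_mul zero_le_two, ENNReal.ofReal_add (by positivity) (by positivity),
          ENNReal.ofReal_mul (norm_nonneg _), ENNReal.ofReal_mul (norm_nonneg _), ofReal_norm,
          ofReal_norm, ENNReal.ofReal_ofNat]
    _ ≤ _ := by
        gcongr
        · exact le_iSup (fun n => ENNReal.ofReal (‖(b : A) - E n (b : A)‖ / β n)) n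
        · exact le_iSup (fun n => ENNReal.ofReal (‖(a : A) - E n (a : A)‖ / β n)) n

theorem towerSeminorm_jordanProduct_le (hE : IsExpectationTower E) (hβ : ∀ n, 0 < β n)
    (a b : selfAdjoint A) : towerSeminorm E β (jordanProduct a b) ≤
      2 * (‖(a : A)‖ₑ * towerSeminorm E β b + ‖(b : A)‖ₑ * towerSeminorm E β a) := by
  refine iSup_le fun n => ?_
  have := hE.norm_smul_mul_add_smul_mul_sub_le hβ n (1 / 2) (1 / 2) (by norm_num) a b
  rwa [← smul_add] at this

theorem towerSeminorm_lieProduct_le (hE : IsExpectationTower E) (hβ : ∀ n, 0 < β n)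
    (a b : selfAdjoint A) : towerSeminorm E β (lieProduct a b) ≤
      2 * (‖(a : A)‖ₑ * towerSeminorm E β b + ‖(b : A)‖ₑ * towerSeminorm E β a) := by
  refine iSup_le fun n => ?_
  have := hE.norm_smul_mul_add_smul_mul_sub_le hβ n (1 / (2 * Complex.I)) (-(1 / (2 * Complex.I)))
    (by norm_num) a b
  rwa [neg_smul, ← sub_eq_add_neg, ← smul_sub] at this

/-- The term `n = 0` alone forces `a` to be a scalar, and self-adjointness makes the scalar real. -/
theorem towerSeminorm_eq_zero_iff (hE : IsExpectationTower E) (hβ : ∀ n, 0 < β n)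
    (a : selfAdjoint A) : towerSeminorm E β a = 0 ↔ ∃ t : ℝ, (a : A) = algebraMap ℝ A t := by
  constructor
  · intro h
    have h0 := (towerSeminorm_le_ofReal_iff (E := E) (a := a) hβ le_rfl).1 (by simp [h]) 0
    rw [zero_mul, norm_le_zero_iff, sub_eq_zero] at h0
    obtain ⟨c, hc⟩ := hE.scalar (a : A)
    rw [hc] at h0
    have hs := a.2
    rw [selfAdjoint.mem_iff, h0] at hs
    rcases subsingleton_or_nontrivial A with hA | hA
    · exact ⟨0, Subsingleton.elim _ _⟩
    · have hs' : algebraMap ℂ A (star c) = algebraMap ℂ A c := by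
        rw [← hs, algebraMap_star_comm]
      have := (algebraMap ℂ A).injective hs'
      refine ⟨c.re, ?_⟩
      rw [h0, IsScalarTower.algebraMap_apply ℝ ℂ A]
      congr 1
      exact ((Complex.conj_eq_iff_re.1 this)).symm
  · rintro ⟨t, ht⟩
    rw [IsScalarTower.algebraMap_apply ℝ ℂ A] at ht
    refine le_antisymm (iSup_le fun n => ?_) zero_le
    rw [ht, hE.apply_algebraMap, sub_self, norm_zero, zero_div, ENNReal.ofReal_zero]

/-- The maps of a tower on self-adjoint elements. -/
noncomputable def onSelfAdjoint (hE : IsExpectationTower E) (n : ℕ) (a : selfAdjoint A) : selfAdjoint A :=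
  ⟨E n a, by rw [selfAdjoint.mem_iff, ← hE.map_star, a.2]⟩

/-- For `n ≥ N` the map `E n` fixes the range of `E N`, so only finitely many terms of the supremum
are nonzero. -/
theorem towerSeminorm_onSelfAdjoint_lt_top (hE : IsExpectationTower E) (hβ : ∀ n, 0 < β n)
    (N : ℕ) (a : selfAdjoint A) : towerSeminorm E β (hE.onSelfAdjoint N a) < ∞ := by
  set f : ℕ → ℝ := fun n => ‖E N a - E n (E N a)‖ / β n with hf
  have hf0 (n) : 0 ≤ f n := div_nonneg (norm_nonneg _) (hβ n).le
  refine lt_of_le_of_lt (b := ENNReal.ofReal (∑ n ∈ Finset.range N, f n)) (iSup_le fun n => ?_)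
    ENNReal.ofReal_lt_top
  refine ENNReal.ofReal_le_ofReal ?_
  change f n ≤ _
  by_cases hn : n < N
  · exact Finset.single_le_sum (fun i _ => hf0 i) (Finset.mem_range.2 hn)
  · have : f n = 0 := by
      rw [hf]
      simp only
      rw [hE.apply_apply_of_ge (not_lt.1 hn), sub_self, norm_zero, zero_div]
    rw [this]
    exact Finset.sum_nonneg fun i _ => hf0 i

/-- For `n ≤ N` the contraction `E N` commutes with `E n`; for `n ≥ N` the term vanishes. -/
theorem towerSeminorm_onSelfAdjoint_le (hE : IsExpectationTower E) (hβ : ∀ n, 0 < β n)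
    (N : ℕ) (a : selfAdjoint A) :
    towerSeminorm E β (hE.onSelfAdjoint N a) ≤ towerSeminorm E β a := by
  refine iSup_mono fun n => ENNReal.ofReal_le_ofReal (div_le_div_of_nonneg_right ?_ (hβ n).le)
  change ‖E N a - E n (E N a)‖ ≤ _
  rcases le_total n N with h | h
  · have : E N (a : A) - E n (E N (a : A)) = E N (a - E n (a : A)) := by
      rw [map_sub, hE.apply_apply_of_le h, hE.apply_apply_of_ge h]
    rw [this]
    exact hE.norm_le N _
  · rw [hE.apply_apply_of_ge h, sub_self, norm_zero]
    exact norm_nonneg _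

theorem dense_towerSeminorm_lt_top (hE : IsExpectationTower E) (hβ : ∀ n, 0 < β n) :
    Dense {a | towerSeminorm E β a < ∞} := fun a =>
  mem_closure_of_tendsto (tendsto_subtype_rng.2 (hE.tendsto (a : A)))
    (Eventually.of_forall fun n => hE.towerSeminorm_onSelfAdjoint_lt_top hβ n a)

/-- States agree on scalars, so an element of the Lip ball may be replaced by `a - E 0 a`, whose
norm is at most `β 0`. -/
theorem apply_sub_apply_zero (hE : IsExpectationTower E) {φ ψ : WeakDual ℂ A}
    (hφ : φ ∈ stateSpace A) (hψ : ψ ∈ stateSpace A) (a : A) :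
    φ a - ψ a = φ (a - E 0 a) - ψ (a - E 0 a) := by
  obtain ⟨c, hc⟩ := hE.scalar a
  rw [hc, map_sub, map_sub, apply_algebraMap_of_mem_stateSpace hφ,
    apply_algebraMap_of_mem_stateSpace hψ]
  ring

theorem isSelfAdjoint_sub (hE : IsExpectationTower E) (n : ℕ) (a : selfAdjoint A) :
    IsSelfAdjoint ((a : A) - E n a) :=
  selfAdjoint.mem_iff.1 (a - hE.onSelfAdjoint n a).2

theorem mongeKantorovich_lt_top (hE : IsExpectationTower E) (hβ : ∀ n, 0 < β n)
    {φ ψ : WeakDual ℂ A} (hφ : φ ∈ stateSpace A) (hψ : ψ ∈ stateSpace A) :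
    mongeKantorovich (towerSeminorm E β) φ ψ < ∞ := by
  refine lt_of_le_of_lt (b := ENNReal.ofReal (β 0 + β 0)) (iSup₂_le fun a ha => ?_)
    ENNReal.ofReal_lt_top
  have h := (towerSeminorm_le_one_iff hβ).1 ha 0
  rw [← ofReal_norm, hE.apply_sub_apply_zero hφ hψ]
  refine ENNReal.ofReal_le_ofReal ((norm_sub_le _ _).trans (add_le_add ?_ ?_))
  · exact (norm_apply_le_of_mem_stateSpace hφ (hE.isSelfAdjoint_sub 0 a)).trans h
  · exact (norm_apply_le_of_mem_stateSpace hψ (hE.isSelfAdjoint_sub 0 a)).trans h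

theorem isCompact_selfAdjoint_range (hE : IsExpectationTower E) (n : ℕ) (R : ℝ) :
    IsCompact {x : A | x ∈ (E n).range ∧ ‖x‖ ≤ R ∧ IsSelfAdjoint x} := by
  have := hE.finiteDimensional n
  have : ProperSpace (E n).range := FiniteDimensional.proper ℂ _
  have h₁ : IsCompact (Subtype.val '' (Metric.closedBall (0 : (E n).range) R)) :=
    (isCompact_closedBall _ _).image continuous_subtype_val
  have h₂ : IsClosed {x : A | star x = x} := isClosed_eq continuous_star continuous_id
  convert h₁.inter_right h₂ using 1
  ext x
  simp only [Set.mem_ofPred_eq, Set.mem_inter_iff, Set.mem_image, Metric.mem_closedBall,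
    dist_zero_right]
  constructor
  · rintro ⟨h, h', h''⟩
    exact ⟨⟨⟨x, h⟩, h', rfl⟩, h''⟩
  · rintro ⟨⟨y, hy, rfl⟩, h''⟩
    exact ⟨y.2, hy, h''⟩

/-- Modulo scalars, the Lip ball lies within `β n` of a compact set in the range of `E n`. A finite
net of that set turns weak* closeness at finitely many points into uniform closeness on the ball. -/
theorem eventually_mongeKantorovich_lt (hE : IsExpectationTower E) (hβ : ∀ n, 0 < β n)
    (hβ0 : Tendsto β atTop (𝓝 0)) {φ : WeakDual ℂ A} (hφ : φ ∈ stateSpace A) {ε : ℝ≥0∞}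
    (hε : 0 < ε) : ∀ᶠ ψ in 𝓝[stateSpace A] φ, mongeKantorovich (towerSeminorm E β) ψ φ < ε := by
  obtain ⟨δ, hδ, hδε⟩ := ENNReal.lt_iff_exists_nnreal_btwn.1 hε
  have hδ0 : (0 : ℝ) < δ := by exact_mod_cast hδ
  -- Five errors are added below: the tail `a - E n a` and the net error `x - y`, each under both
  -- states, and the discrepancy of the states at the net point `y`.
  obtain ⟨n, hn⟩ := (hβ0.eventually (gt_mem_nhds (show (0 : ℝ) < δ / 5 by positivity))).exists
  obtain ⟨t, htK, ht, hcov⟩ := (hE.isCompact_selfAdjoint_range n (β 0)).finite_cover_balls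
    (show (0 : ℝ) < δ / 5 by positivity)
  have hev : ∀ᶠ ψ in 𝓝 φ, ∀ y ∈ t, ‖ψ y - φ y‖ < δ / 5 := by
    refine (eventually_all_finite ht).2 fun y _ => ?_
    have := (WeakDual.eval_continuous (𝕜 := ℂ) y).tendsto φ
    have := this.sub_const (φ y)
    rw [sub_self] at this
    have := this.norm
    rw [norm_zero] at this
    exact this.eventually (gt_mem_nhds (by positivity))
  filter_upwards [nhdsWithin_le_nhds hev, self_mem_nhdsWithin] with ψ hψt hψ
  refine lt_of_le_of_lt (iSup₂_le fun a ha => ?_) hδε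
  have h := (towerSeminorm_le_one_iff hβ).1 ha
  rw [← ofReal_norm, ← ENNReal.ofReal_coe_nnreal, hE.apply_sub_apply_zero hψ hφ]
  refine ENNReal.ofReal_le_ofReal ?_
  set x : A := E n ((a : A) - E 0 a) with hx
  have hxsa : IsSelfAdjoint x := by
    rw [IsSelfAdjoint, hx, ← hE.map_star, hE.isSelfAdjoint_sub 0 a]
  have hxK : x ∈ {x : A | x ∈ (E n).range ∧ ‖x‖ ≤ β 0 ∧ IsSelfAdjoint x} :=
    ⟨⟨_, rfl⟩, (hE.norm_le n _).trans (h 0), hxsa⟩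
  obtain ⟨y, hy, hxy⟩ := Set.mem_iUnion₂.1 (hcov hxK)
  have hysa : IsSelfAdjoint y := (htK hy).2.2
  have e : (a : A) - E 0 a = ((a : A) - E n a) + (x - y) + y := by
    rw [hx, map_sub, hE.apply_apply_of_ge (Nat.zero_le n)]
    abel
  have b₁ {χ : WeakDual ℂ A} (hχ : χ ∈ stateSpace A) : ‖χ ((a : A) - E n a)‖ ≤ δ / 5 :=
    (norm_apply_le_of_mem_stateSpace hχ (hE.isSelfAdjoint_sub n a)).trans ((h n).trans hn.le)
  have b₂ {χ : WeakDual ℂ A} (hχ : χ ∈ stateSpace A) : ‖χ (x - y)‖ ≤ δ / 5 :=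
    (norm_apply_le_of_mem_stateSpace hχ (hxsa.sub hysa)).trans
      (by rw [← dist_eq_norm]; exact (Metric.mem_ball.1 hxy).le)
  rw [e, map_add, map_add, map_add, map_add]
  have e' : ψ ((a : A) - E n a) + ψ (x - y) + ψ y - (φ ((a : A) - E n a) + φ (x - y) + φ y) =
    (ψ ((a : A) - E n a) - φ ((a : A) - E n a)) + (ψ (x - y) - φ (x - y)) + (ψ y - φ y) := by ring
  rw [e']
  calc _ ≤ ((δ : ℝ) / 5 + δ / 5) + (δ / 5 + δ / 5) + δ / 5 := by
        refine norm_add₃_le.trans (add_le_add (add_le_add ?_ ?_) (hψt y hy).le)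
        · exact (norm_sub_le _ _).trans (add_le_add (b₁ hψ) (b₁ hφ))
        · exact (norm_sub_le _ _).trans (add_le_add (b₂ hψ) (b₂ hφ))
    _ = δ := by ring

end IsExpectationTower

/-! ### The Monge–Kantorovich metric against the weak* topology -/

section MongeKantorovich

variable {A : Type*} [CStarAlgebra A] {L : selfAdjoint A → ℝ≥0∞}

theorem mongeKantorovich_self (φ : WeakDual ℂ A) : mongeKantorovich L φ φ = 0 :=
  le_antisymm (iSup₂_le fun a _ => by rw [sub_self, enorm_zero]) zero_le

/-- Approximate `a` by an element `d` of the dense domain. With `L d < M`, the rescaled `d / M` lies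
in the Lip ball, where the metric controls the states uniformly. -/
theorem exists_norm_apply_sub_lt_of_mongeKantorovich_lt
    (hL : ∀ (t : ℝ) a, L (t • a) = ‖t‖ₑ * L a) (hd : Dense {a | L a < ∞})
    {φ : WeakDual ℂ A} (hφ : φ ∈ stateSpace A) (a : selfAdjoint A) {ε : ℝ} (hε : 0 < ε) :
    ∃ δ : ℝ≥0∞, 0 < δ ∧ ∀ ψ ∈ stateSpace A, mongeKantorovich L ψ φ < δ →
      ‖ψ (a : A) - φ (a : A)‖ < ε := by
  obtain ⟨d, had, hd⟩ := Metric.dense_iff.1 hd a (ε / 3) (by positivity)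
  obtain ⟨M, hM⟩ := ENNReal.lt_iff_exists_nnreal_btwn.1 hd.out
  have hM0 : (0 : ℝ) < M := by exact_mod_cast (zero_le.trans_lt hM.1)
  have hLd : L ((M : ℝ)⁻¹ • d) ≤ 1 := by
    rw [hL, ← ofReal_norm, norm_inv, Real.norm_of_nonneg hM0.le, ENNReal.ofReal_inv_of_pos hM0,
      ENNReal.ofReal_coe_nnreal]
    refine (mul_le_mul_right hM.1.le _).trans ?_
    exact ENNReal.inv_mul_le_one _
  refine ⟨ENNReal.ofReal (ε / 3 / M), ENNReal.ofReal_pos.2 (by positivity), fun ψ hψ h => ?_⟩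
  have h₁ := (le_iSup₂ (f := fun (a : selfAdjoint A) (_ : L a ≤ 1) => ‖ψ (a : A) - φ (a : A)‖ₑ)
    _ hLd).trans_lt h
  have hs (χ : WeakDual ℂ A) : χ ((M : ℝ)⁻¹ • (d : A)) = (M : ℝ)⁻¹ • χ (d : A) :=
    map_real_smul χ χ.continuous _ _
  have h₂ : ‖ψ (d : A) - φ (d : A)‖ < ε / 3 := by
    rw [← ofReal_norm, ENNReal.ofReal_lt_ofReal_iff (by positivity), selfAdjoint.val_smul,
      hs ψ, hs φ, ← smul_sub, norm_smul, norm_inv,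
      Real.norm_of_nonneg hM0.le, lt_div_iff₀ hM0] at h₁
    calc _ = (M : ℝ)⁻¹ * ‖ψ (d : A) - φ (d : A)‖ * M := by field_simp
      _ < _ := h₁
  have b {χ : WeakDual ℂ A} (hχ : χ ∈ stateSpace A) : ‖χ ((a : A) - d)‖ < ε / 3 := by
    refine (norm_apply_le_of_mem_stateSpace hχ (a.2.sub d.2 : IsSelfAdjoint ((a : A) - d))).trans_lt ?_
    rw [← dist_eq_norm, dist_comm]
    exact had
  have e : ψ (a : A) - φ (a : A) =
      ψ ((a : A) - d) - φ ((a : A) - d) + (ψ (d : A) - φ (d : A)) := by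
    rw [map_sub, map_sub]
    ring
  rw [e]
  calc _ ≤ ‖ψ ((a : A) - d)‖ + ‖φ ((a : A) - d)‖ + ‖ψ (d : A) - φ (d : A)‖ :=
        (norm_add_le _ _).trans (add_le_add (norm_sub_le _ _) le_rfl)
    _ < ε / 3 + ε / 3 + ε / 3 := by
        gcongr
        · exact b hψ
        · exact b hφ
    _ = ε := by ring

/-- One comparison of filters is `hmk`. For the other, metric convergence gives convergence at each
self-adjoint element, hence at every element through its real and imaginary parts. -/
theorem nhdsWithin_stateSpace_hasBasis (hL : ∀ (t : ℝ) a, L (t • a) = ‖t‖ₑ * L a)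
    (hd : Dense {a | L a < ∞}) {φ : WeakDual ℂ A} (hφ : φ ∈ stateSpace A)
    (hmk : ∀ ε : ℝ≥0∞, 0 < ε → ∀ᶠ ψ in 𝓝[stateSpace A] φ, mongeKantorovich L ψ φ < ε) :
    (𝓝[stateSpace A] φ).HasBasis (fun ε : ℝ≥0∞ => 0 < ε)
      fun ε => {ψ ∈ stateSpace A | mongeKantorovich L ψ φ < ε} := by
  have hB : (⨅ (ε : ℝ≥0∞) (_ : 0 < ε),
      𝓟 {ψ ∈ stateSpace A | mongeKantorovich L ψ φ < ε}).HasBasis (fun ε : ℝ≥0∞ => 0 < ε)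
      fun ε => {ψ ∈ stateSpace A | mongeKantorovich L ψ φ < ε} := by
    refine hasBasis_biInf_principal' (fun ε hε δ hδ => ⟨min ε δ, lt_min hε hδ, ?_, ?_⟩)
      ⟨1, one_pos⟩
    · exact fun ψ h => ⟨h.1, h.2.trans_le (min_le_left _ _)⟩
    · exact fun ψ h => ⟨h.1, h.2.trans_le (min_le_right _ _)⟩
  suffices h : 𝓝[stateSpace A] φ = ⨅ (ε : ℝ≥0∞) (_ : 0 < ε),
      𝓟 {ψ ∈ stateSpace A | mongeKantorovich L ψ φ < ε} by rw [h]; exact hB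
  refine le_antisymm (hB.ge_iff.2 fun ε hε => ?_) (le_inf ?_ ?_)
  · exact (eventually_mem_nhdsWithin).and (hmk ε hε)
  · refine tendsto_id'.1 ?_
    refine tendsto_iff_forall_eval_tendsto_topDualPairing.2 fun a => ?_
    have sa (a : selfAdjoint A) : Tendsto (fun ψ : WeakDual ℂ A => ψ (a : A))
        (⨅ (ε : ℝ≥0∞) (_ : 0 < ε), 𝓟 {ψ ∈ stateSpace A | mongeKantorovich L ψ φ < ε})
        (𝓝 (φ (a : A))) := by
      refine (hB.tendsto_iff Metric.nhds_basis_ball).2 fun ε hε => ?_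
      obtain ⟨δ, hδ, h⟩ := exists_norm_apply_sub_lt_of_mongeKantorovich_lt hL hd hφ a hε
      exact ⟨δ, hδ, fun ψ hψ => by
        rw [Metric.mem_ball, dist_eq_norm]
        exact h ψ hψ.1 hψ.2⟩
    have e (ψ : WeakDual ℂ A) : ψ a = ψ (realPart a : A) + Complex.I • ψ (imaginaryPart a : A) := by
      conv_lhs => rw [← realPart_add_I_smul_imaginaryPart a, map_add, map_smul]
    change Tendsto (fun ψ : WeakDual ℂ A => ψ a) _ (𝓝 (φ a))
    exact (((sa (realPart a)).add ((sa (imaginaryPart a)).const_smul Complex.I)).congr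
      fun ψ => (e ψ).symm).trans (by rw [← e])
  · exact (hB.ge_iff.1 le_rfl 1 one_pos) |> fun h => le_principal_iff.2
      (mem_of_superset h fun ψ hψ => hψ.1)

end MongeKantorovich

theorem IsExpectationTower.isQuantumCompactMetricSpace {A : Type*} [CStarAlgebra A] [Nontrivial A]
    {E : ℕ → A →L[ℂ] A} {β : ℕ → ℝ} (hE : IsExpectationTower E) (hβ : ∀ n, 0 < β n)
    (hβ0 : Tendsto β atTop (𝓝 0)) : IsQuantumCompactMetricSpace 2 0 (towerSeminorm E β) where
  nontrivial := inferInstance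
  map_add_le := towerSeminorm_add_le hβ
  map_smul := towerSeminorm_smul
  dense_domain := hE.dense_towerSeminorm_lt_top hβ
  eq_zero_iff := hE.towerSeminorm_eq_zero_iff hβ
  jordan_le a b _ _ := (hE.towerSeminorm_jordanProduct_le hβ a b).trans le_self_add
  lie_le a b _ _ := (hE.towerSeminorm_lieProduct_le hβ a b).trans le_self_add
  mongeKantorovich_lt_top _ hφ _ hψ := hE.mongeKantorovich_lt_top hβ hφ hψ
  nhdsWithin_hasBasis _ hφ := nhdsWithin_stateSpace_hasBasis towerSeminorm_smul
    (hE.dense_towerSeminorm_lt_top hβ) hφ fun _ hε =>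
      hE.eventually_mongeKantorovich_lt hβ hβ0 hφ hε
  lowerSemicontinuous := lowerSemicontinuous_towerSeminorm

/-! ### Trace-preserving conditional expectations onto finite-dimensional subalgebras -/

section TracialExpectation

open scoped ComplexOrder

variable {A B : Type*} [CStarAlgebra A] [CStarAlgebra B]

/-- `ρ` is, up to the embedding `ι`, a `μ`-preserving conditional expectation of `A` onto `B`. -/
structure IsTracialExpectation (ι : B →⋆ₐ[ℂ] A) (μ : WeakDual ℂ A) (ρ : A →L[ℂ] B) : Prop where
  apply_map : ∀ b, ρ (ι b) = b
  map_mul_left : ∀ b a, ρ (ι b * a) = b * ρ a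
  map_mul_right : ∀ a b, ρ (a * ι b) = ρ a * b
  trace_apply : ∀ a, μ (ι (ρ a)) = μ a
  map_star : ∀ a, ρ (star a) = star (ρ a)
  map_nonneg : ∀ a, ∃ b, ρ (star a * a) = star b * b
  norm_le : ∀ a, ‖ρ a‖ ≤ ‖a‖

/-- `μ` is faithful on the image of `ι`. -/
def IsFaithfulOn (ι : B →⋆ₐ[ℂ] A) (μ : WeakDual ℂ A) : Prop :=
  ∀ b, μ (ι (star b * b)) = 0 → b = 0

variable {ι : B →⋆ₐ[ℂ] A} {μ : WeakDual ℂ A}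

/-- Test with `b = star (x - y)`. This nondegeneracy is the source of every identity satisfied by
the expectations. -/
theorem IsFaithfulOn.eq_of_forall_mul (hf : IsFaithfulOn ι μ) {x y : B}
    (h : ∀ b, μ (ι (b * x)) = μ (ι (b * y))) : x = y := by
  refine sub_eq_zero.1 (hf _ ?_)
  rw [mul_sub, map_sub, map_sub, h, sub_self]

/-- The pairing `μ (ι (b * x))` on `B` is nondegenerate, hence perfect in finite dimension, so each
functional `b ↦ μ (ι b * a)` is represented by an element of `B`. -/
theorem IsFaithfulOn.exists_riesz [FiniteDimensional ℂ B] (hf : IsFaithfulOn ι μ) :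
    ∃ ρ : A →ₗ[ℂ] B, ∀ a b, μ (ι (b * ρ a)) = μ (ι b * a) := by
  let T : B →ₗ[ℂ] Module.Dual ℂ B := LinearMap.mk₂ ℂ (fun x b => μ (ι (b * x)))
    (by intros; simp only [mul_add, map_add]) (by intros; simp only [mul_smul_comm, map_smul])
    (by intros; simp only [add_mul, map_add]) (by intros; simp only [smul_mul_assoc, map_smul])
  let G : A →ₗ[ℂ] Module.Dual ℂ B := LinearMap.mk₂ ℂ (fun a b => μ (ι b * a))
    (by intros; simp only [mul_add, map_add]) (by intros; simp only [mul_smul_comm, map_smul])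
    (by intros; simp only [add_mul, map_add]) (by intros; simp only [smul_mul_assoc, map_smul])
  have hT : Function.Injective T := fun x y h =>
    hf.eq_of_forall_mul fun b => LinearMap.congr_fun h b
  let e := LinearMap.linearEquivOfInjective T hT Subspace.dual_finrank_eq.symm
  refine ⟨e.symm.toLinearMap ∘ₗ G, fun a b => ?_⟩
  have : T (e.symm (G a)) = G a := e.apply_symm_apply (G a)
  exact LinearMap.congr_fun this b

/-- Testing with `b = h⁻` gives the trace of `-(h⁻)³`, which is both nonnegative and nonpositive.
Faithfulness then kills `h⁻`; writing `h⁻ = star y * y` exhibits the cube as a square. -/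
theorem exists_eq_star_mul_self_of_faithful (hμ : IsTracialState μ) (hf : IsFaithfulOn ι μ) {h : B}
    (hsa : IsSelfAdjoint h) (hpos : ∀ b : B, 0 ≤ μ (ι (star b * h * b))) :
    ∃ b, h = star b * b := by
  let _ := CStarAlgebra.spectralOrder B
  have := CStarAlgebra.spectralOrderedRing B
  refine CStarAlgebra.nonneg_iff_eq_star_mul_self.1 ?_
  obtain ⟨y, hy⟩ := CStarAlgebra.nonneg_iff_eq_star_mul_self.1 (CFC.negPart_nonneg h)
  have hn : star (h⁻) = h⁻ := (CFC.negPart_nonneg h).isSelfAdjoint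
  have e : star (h⁻) * h * h⁻ = -(star (y * h⁻) * (y * h⁻)) := by
    have : h * h⁻ = -(h⁻ * h⁻) := by
      calc h * h⁻ = (h⁺ - h⁻) * h⁻ := by rw [CFC.posPart_sub_negPart h hsa]
        _ = _ := by rw [sub_mul, CFC.posPart_mul_negPart, zero_sub]
    rw [mul_assoc, this, star_mul, hn]
    conv_rhs => rw [mul_assoc, ← mul_assoc (star y), ← hy]
    rw [mul_neg]
  have h₁ := hpos (h⁻)
  have h₂ := hμ.1.2 (ι (y * h⁻))
  rw [← map_star, ← map_mul] at h₂
  rw [e, map_neg, map_neg, Left.nonneg_neg_iff] at h₁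
  have h₃ := hf _ (le_antisymm h₁ h₂)
  have h₄ : star (h⁻ * h⁻) * (h⁻ * h⁻) = 0 := by
    have : h⁻ * h⁻ = 0 := by
      calc h⁻ * h⁻ = star y * (y * h⁻) := by rw [← mul_assoc, ← hy]
        _ = 0 := by rw [h₃, mul_zero]
    rw [this, mul_zero]
  have h₅ := CStarRing.star_mul_self_eq_zero_iff _ |>.1 h₄
  have h₆ : h⁻ = 0 := by
    rw [← CStarRing.star_mul_self_eq_zero_iff, hn, h₅]
  exact (CFC.negPart_eq_zero_iff h hsa).1 h₆

/-- The Riesz representative is unique, which forces the bimodule and star properties; the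
right-hand one uses the trace identity. Positivity is checked against the trace, and contractivity
follows from a Kadison–Schwarz inequality. -/
theorem exists_isTracialExpectation [FiniteDimensional ℂ B] (hμ : IsTracialState μ)
    (hf : IsFaithfulOn ι μ) : ∃ ρ : A →L[ℂ] B, IsTracialExpectation ι μ ρ := by
  obtain ⟨ρ, hρ⟩ := hf.exists_riesz
  have hmap (b : B) : ρ (ι b) = b := hf.eq_of_forall_mul fun c => by rw [hρ, map_mul ι]
  have hleft (b : B) (a : A) : ρ (ι b * a) = b * ρ a := hf.eq_of_forall_mul fun c => by
    rw [hρ, ← mul_assoc, ← mul_assoc, ← map_mul, hρ]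
  have hright (a : A) (b : B) : ρ (a * ι b) = ρ a * b := hf.eq_of_forall_mul fun c => by
    rw [hρ, ← mul_assoc, hμ.2, ← mul_assoc, ← map_mul ι, ← hρ, ← mul_assoc, map_mul ι _ b,
      hμ.2 _ (ι b), ← map_mul ι, mul_assoc]
  have htr (a : A) : μ (ι (ρ a)) = μ a := by
    have := hρ a 1
    rwa [one_mul, map_one, one_mul] at this
  have hstar (a : A) : ρ (star a) = star (ρ a) := hf.eq_of_forall_mul fun c => by
    have e₁ : ι c * star a = star (a * ι (star c)) := by rw [star_mul, map_star ι, star_star]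
    have e₂ : ι (c * star (ρ a)) = star (ι (ρ a * star c)) := by
      rw [← map_star ι, star_mul, star_star]
    rw [hρ, e₁, e₂, apply_star_of_mem_stateSpace hμ.1, apply_star_of_mem_stateSpace hμ.1, ← hright,
      htr]
  have hnonneg (a : A) : ∃ b, ρ (star a * a) = star b * b := by
    refine exists_eq_star_mul_self_of_faithful hμ hf ?_ fun b => ?_
    · rw [IsSelfAdjoint, ← hstar, star_mul, star_star]
    · have := hμ.1.2 (a * ι b)
      rwa [star_mul, ← map_star, mul_assoc, ← mul_assoc (star a), ← htr, hleft, hright,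
        ← mul_assoc] at this
  have hnorm (a : A) : ‖ρ a‖ ≤ 1 * ‖a‖ := by
    rw [one_mul]
    let _ := CStarAlgebra.spectralOrder B
    have := CStarAlgebra.spectralOrderedRing B
    have hpos (a : A) : 0 ≤ ρ (star a * a) := CStarAlgebra.nonneg_iff_eq_star_mul_self.2 (hnonneg a)
    have hone : ρ 1 = 1 := by rw [← map_one ι, hmap]
    -- Kadison–Schwarz: expand the positive element `ρ` of the square of `a - ι (ρ a)` by the
    -- bimodule property.
    have h₁ : star (ρ a) * ρ a ≤ ρ (star a * a) := by
      have := hpos (a - ι (ρ a))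
      have e : star (a - ι (ρ a)) * (a - ι (ρ a)) =
          star a * a - star a * ι (ρ a) - ι (star (ρ a)) * a + ι (star (ρ a)) * ι (ρ a) := by
        rw [star_sub, ← map_star]
        noncomm_ring
      rw [e, map_add, map_sub, map_sub, hright, hleft, hleft, hmap, hstar] at this
      rw [← sub_nonneg]
      calc (0 : B) ≤ _ := this
        _ = _ := by abel
    have h₂ : ρ (star a * a) ≤ algebraMap ℝ B ‖star a * a‖ := by
      obtain ⟨b, hb⟩ := (exists_star_mul_self_norm_sub (IsSelfAdjoint.star_mul_self a)).1
      have := hpos b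
      rw [← hb, map_sub, IsScalarTower.algebraMap_apply ℝ ℂ A, Algebra.algebraMap_eq_smul_one (R := ℂ),
        map_smul, hone, ← Algebra.algebraMap_eq_smul_one (R := ℂ),
        ← IsScalarTower.algebraMap_apply ℝ ℂ B, sub_nonneg] at this
      exact this
    have h₃ := CStarAlgebra.norm_le_norm_of_nonneg_of_le (star_mul_self_nonneg (ρ a)) (h₁.trans h₂)
    rw [CStarRing.norm_star_mul_self] at h₃
    have h₄ : ‖algebraMap ℝ B ‖star a * a‖‖ ≤ ‖a‖ * ‖a‖ := by
      rcases subsingleton_or_nontrivial B with hB | hB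
      · rw [Subsingleton.elim (algebraMap ℝ B _) 0, norm_zero]
        positivity
      · rw [norm_algebraMap', norm_norm, CStarRing.norm_star_mul_self]
    exact abs_le_of_sq_le_sq' (by nlinarith) (norm_nonneg _) |>.2
  exact ⟨LinearMap.mkContinuous ρ 1 hnorm, hmap, hleft, hright, htr, hstar, hnonneg,
    fun a => by simpa using hnorm a⟩

theorem IsTracialExpectation.isConditionalExpectation [Nontrivial A] {ρ : A →L[ℂ] B}
    (hρ : IsTracialExpectation ι μ ρ) (hι : Isometry ι) :
    IsConditionalExpectation ι.range (⟨(ι : B →ₗ[ℂ] A), hι.continuous⟩ ∘L ρ) where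
  mem a := ⟨ρ a, rfl⟩
  apply_of_mem := by
    rintro _ ⟨b, rfl⟩
    exact congrArg ι (hρ.apply_map b)
  map_nonneg a := by
    obtain ⟨b, hb⟩ := hρ.map_nonneg a
    refine ⟨ι b, ?_⟩
    change ι (ρ (star a * a)) = _
    rw [hb, _root_.map_mul ι, StarHomClass.map_star ι]
  norm_eq_one := by
    have hn (b : B) : ‖ι b‖ = ‖b‖ := by
      have := hι.norm_map_of_map_zero (map_zero ι) b
      exact this
    refine le_antisymm (ContinuousLinearMap.opNorm_le_bound _ zero_le_one fun a => ?_) ?_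
    · rw [one_mul]
      exact (hn _).trans_le (hρ.norm_le a)
    · have h := ContinuousLinearMap.le_opNorm
        ((⟨(ι : B →ₗ[ℂ] A), hι.continuous⟩ : B →L[ℂ] A) ∘L ρ) 1
      have e : ((⟨(ι : B →ₗ[ℂ] A), hι.continuous⟩ : B →L[ℂ] A) ∘L ρ) 1 = 1 := by
        change ι (ρ 1) = 1
        rw [← map_one ι, hρ.apply_map]
      rwa [e, norm_one, mul_one] at h
  map_mul_mul := by
    rintro _ ⟨b, rfl⟩ _ ⟨c, rfl⟩ a
    change ι (ρ (ι b * a * ι c)) = ι b * ι (ρ a) * ι c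
    rw [hρ.map_mul_right, hρ.map_mul_left, map_mul, map_mul]

/-- `condExpectation` is a choice, but any trace-preserving bimodule map onto the range has the same
pairing `μ (ι b * ·)` with the subalgebra, and faithfulness makes that pairing decisive. -/
theorem IsTracialExpectation.condExpectation_apply [Nontrivial A] {ρ : A →L[ℂ] B}
    (hρ : IsTracialExpectation ι μ ρ) (hι : Isometry ι) (hf : IsFaithfulOn ι μ) (a : A) :
    condExpectation ι.range μ a = ι (ρ a) := by
  have hspec : IsConditionalExpectation ι.range (condExpectation ι.range μ) ∧
      ∀ a, μ (condExpectation ι.range μ a) = μ a :=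
    Classical.epsilon_spec (p := fun E => IsConditionalExpectation ι.range E ∧ ∀ a, μ (E a) = μ a)
      ⟨_, hρ.isConditionalExpectation hι, hρ.trace_apply⟩
  obtain ⟨x, hx⟩ := hspec.1.mem a
  have hx : ι x = condExpectation ι.range μ a := hx
  rw [← hx]
  congr 1
  refine hf.eq_of_forall_mul fun b => ?_
  have h := hspec.1.map_mul_mul (ι b) ⟨b, rfl⟩ 1 (one_mem _) a
  rw [mul_one, mul_one, ← hx, ← map_mul] at h
  rw [← h, hspec.2, ← hρ.map_mul_left, hρ.trace_apply]

end TracialExpectation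

/-! ### Bridges with pivot 1 -/

section Bridges

open scoped ComplexOrder

theorem hausdorffDistance_mongeKantorovich_self {A : Type*} [CStarAlgebra A]
    (L : selfAdjoint A → ℝ≥0∞) (S : Set (WeakDual ℂ A)) :
    hausdorffDistance (mongeKantorovich L) S S = 0 := by
  refine le_antisymm (max_le ?_ ?_) zero_le <;>
  exact iSup₂_le fun φ hφ => (iInf₂_le φ hφ).trans_eq (mongeKantorovich_self φ)

theorem oneLevelSet_one {D : Type*} [CStarAlgebra D] : oneLevelSet (1 : D) = stateSpace D := by
  ext φ
  simp [oneLevelSet]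

theorem dualMap_mem_stateSpace {A D : Type*} [CStarAlgebra A] [CStarAlgebra D] (π : A →⋆ₐ[ℂ] D)
    {φ : WeakDual ℂ D} (hφ : φ ∈ stateSpace D) : dualMap π φ ∈ stateSpace A := by
  refine ⟨?_, fun a => ?_⟩
  · rw [dualMap_apply, map_one, hφ.1]
  · rw [dualMap_apply, map_mul, map_star]
    exact hφ.2 _

/-- A positive left inverse `ρ` of `π` extends any state `φ` of `A` to the state `φ ∘ ρ` of `D`.
This is what makes the height of the bridges below vanish. -/
theorem dualMap_image_stateSpace {A D : Type*} [CStarAlgebra A] [CStarAlgebra D] (π : A →⋆ₐ[ℂ] D)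
    (ρ : D →L[ℂ] A) (h : ∀ a, ρ (π a) = a) (hρ : ∀ a, ∃ b, ρ (star a * a) = star b * b) :
    dualMap π '' stateSpace D = stateSpace A := by
  refine Set.Subset.antisymm ?_ fun φ hφ => ?_
  · rintro _ ⟨φ, hφ, rfl⟩
    exact dualMap_mem_stateSpace π hφ
  · refine ⟨StrongDual.toWeakDual ((WeakDual.toStrongDual φ).comp ρ), ⟨?_, fun a => ?_⟩, ?_⟩
    · change φ (ρ 1) = 1
      rw [← map_one π, h, hφ.1]
    · obtain ⟨b, hb⟩ := hρ a
      change 0 ≤ φ (ρ (star a * a))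
      rw [hb]
      exact hφ.2 b
    · exact DFunLike.ext _ _ fun a => congrArg φ (h a)

/-- The bridge with pivot `1` given by two unital embeddings into `D`. -/
def unitalBridge {A B D : Type} [CStarAlgebra A] [CStarAlgebra B] [CStarAlgebra D]
    (π : A →⋆ₐ[ℂ] D) (ρ : B →⋆ₐ[ℂ] D) (hπ : Function.Injective π) (hρ : Function.Injective ρ)
    (h : (stateSpace D).Nonempty) : Bridge A B where
  space := D
  pivot := 1
  left := π
  right := ρ
  left_injective := hπ
  right_injective := hρ
  oneLevelSet_nonempty := by rwa [oneLevelSet_one]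

/-- With pivot 1 the 1-level set is the whole state space, so the two surjectivity hypotheses leave
only the reach. -/
theorem length_unitalBridge_le {A B D : Type} [CStarAlgebra A] [CStarAlgebra B] [CStarAlgebra D]
    (π : A →⋆ₐ[ℂ] D) (ρ : B →⋆ₐ[ℂ] D) (hπ : Function.Injective π) (hρ : Function.Injective ρ)
    (h : (stateSpace D).Nonempty) {LA : selfAdjoint A → ℝ≥0∞} {LB : selfAdjoint B → ℝ≥0∞}
    (hπS : dualMap π '' stateSpace D = stateSpace A)
    (hρS : dualMap ρ '' stateSpace D = stateSpace B) {c : ℝ}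
    (hA : ∀ a : selfAdjoint A, LA a ≤ 1 → ∃ b : selfAdjoint B, LB b ≤ 1 ∧
      ‖π (a : A) - ρ (b : B)‖ ≤ c)
    (hB : ∀ b : selfAdjoint B, LB b ≤ 1 → ∃ a : selfAdjoint A, LA a ≤ 1 ∧
      ‖π (a : A) - ρ (b : B)‖ ≤ c) :
    (unitalBridge π ρ hπ hρ h).length LA LB ≤ ENNReal.ofReal c := by
  have hs (a : A) (b : B) : (unitalBridge π ρ hπ hρ h).seminorm a b =
      ENNReal.ofReal ‖π a - ρ b‖ := by
    change ‖π a * 1 - 1 * ρ b‖ₑ = _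
    rw [mul_one, one_mul, ofReal_norm]
  refine max_le ?_ (max_le (iSup₂_le fun a ha => ?_) (iSup₂_le fun b hb => ?_))
  · refine le_trans (le_of_eq ?_) zero_le
    change max (hausdorffDistance _ _ (dualMap π '' oneLevelSet (1 : D)))
      (hausdorffDistance _ _ (dualMap ρ '' oneLevelSet (1 : D))) = 0
    rw [oneLevelSet_one, hπS, hρS, hausdorffDistance_mongeKantorovich_self,
      hausdorffDistance_mongeKantorovich_self, max_self]
  · obtain ⟨b, hb, hab⟩ := hA a ha
    refine (iInf₂_le b hb).trans ?_
    exact (hs a b).trans_le (ENNReal.ofReal_le_ofReal hab)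
  · obtain ⟨a, ha, hab⟩ := hB b hb
    refine (iInf₂_le a ha).trans ?_
    exact (hs a b).trans_le (ENNReal.ofReal_le_ofReal hab)

end Bridges

/-- The image of a self-adjoint element under a ⋆-morphism. -/
def StarAlgHom.onSelfAdjoint {A B : Type*} [CStarAlgebra A] [CStarAlgebra B] (ι : B →⋆ₐ[ℂ] A)
    (b : selfAdjoint B) : selfAdjoint A :=
  ⟨ι b, by rw [selfAdjoint.mem_iff, ← map_star, b.2]⟩

/-! ### From an algebra to one of its finite stages -/

section Intertwining

theorem IsExpectationTower.of_intertwining {A B : Type*} [CStarAlgebra A] [CStarAlgebra B]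
    [FiniteDimensional ℂ B] {E : ℕ → A →L[ℂ] A} (hE : IsExpectationTower E) {E' : ℕ → B →L[ℂ] B}
    {ι : B →⋆ₐ[ℂ] A} (hι : Isometry ι) (h : ∀ n b, ι (E' n b) = E n (ι b)) :
    IsExpectationTower E' where
  norm_le n b := by
    have hn (b : B) : ‖ι b‖ = ‖b‖ := hι.norm_map_of_map_zero (map_zero ι) b
    rw [← hn, h, ← hn b]
    exact hE.norm_le n _
  map_star n b := hι.injective (by
    rw [h, StarHomClass.map_star ι, StarHomClass.map_star ι, h, hE.map_star])
  map_one n := hι.injective (by rw [h, _root_.map_one ι, hE.map_one])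
  map_mul n a b := hι.injective (by rw [h, _root_.map_mul ι, h, h, hE.map_mul])
  apply_apply_of_le hmn b := hι.injective (by rw [h, h, h, hE.apply_apply_of_le hmn])
  apply_apply_of_ge hmn b := hι.injective (by rw [h, h, hE.apply_apply_of_ge hmn])
  scalar b := by
    obtain ⟨c, hc⟩ := hE.scalar (ι b)
    refine ⟨c, hι.injective ?_⟩
    rw [h, hc]
    exact (AlgHomClass.commutes ι c).symm
  finiteDimensional n := inferInstance
  tendsto b := by
    refine hι.isEmbedding.tendsto_nhds_iff.2 ?_
    simp only [Function.comp_def, h]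
    exact hE.tendsto (ι b)

theorem towerSeminorm_onSelfAdjoint_of_intertwining {A B : Type*} [CStarAlgebra A] [CStarAlgebra B]
    {E : ℕ → A →L[ℂ] A} {E' : ℕ → B →L[ℂ] B} {ι : B →⋆ₐ[ℂ] A} (hι : Isometry ι)
    (h : ∀ n b, ι (E' n b) = E n (ι b)) (β : ℕ → ℝ) (b : selfAdjoint B) :
    towerSeminorm E β (ι.onSelfAdjoint b) = towerSeminorm E' β b := by
  refine iSup_congr fun n => ?_
  have hn (b : B) : ‖ι b‖ = ‖b‖ := hι.norm_map_of_map_zero (map_zero ι) b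
  change ENNReal.ofReal (‖ι b - E n (ι b)‖ / β n) = _
  rw [← h, ← map_sub, hn]

/-- Take `A` itself as the bridge algebra. Matching `b` with `ι b` costs nothing; matching `a` with
`ρ a`, that is with `E N a`, does not increase the seminorm and moves a Lip-ball element by at most
`β N`. -/
theorem exists_bridge_length_le_of_intertwining {A B : Type} [CStarAlgebra A] [CStarAlgebra B]
    {E : ℕ → A →L[ℂ] A} (hE : IsExpectationTower E) {E' : ℕ → B →L[ℂ] B}
    {ι : B →⋆ₐ[ℂ] A} (hι : Isometry ι) (h : ∀ n b, ι (E' n b) = E n (ι b))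
    {β : ℕ → ℝ} (hβ : ∀ n, 0 < β n) {μ : WeakDual ℂ A} (hμ : μ ∈ stateSpace A) {ρ : A →L[ℂ] B}
    (hρ : IsTracialExpectation ι μ ρ) {N : ℕ} (hN : ∀ a, ι (ρ a) = E N a) :
    ∃ γ : Bridge A B, γ.length (towerSeminorm E β) (towerSeminorm E' β) ≤
      ENNReal.ofReal (β N) := by
  refine ⟨unitalBridge (StarAlgHom.id ℂ A) ι Function.injective_id hι.injective ⟨μ, hμ⟩,
    length_unitalBridge_le _ _ _ _ _ ?_ (dualMap_image_stateSpace ι ρ hρ.apply_map hρ.map_nonneg)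
    (fun a ha => ?_) (fun b hb => ⟨ι.onSelfAdjoint b, ?_, ?_⟩)⟩
  · exact dualMap_image_stateSpace _ (ContinuousLinearMap.id ℂ A) (fun _ => rfl)
      fun a => ⟨a, rfl⟩
  · refine ⟨⟨ρ a, by rw [selfAdjoint.mem_iff, ← hρ.map_star, a.2]⟩, ?_, ?_⟩
    · rw [← towerSeminorm_onSelfAdjoint_of_intertwining hι h]
      have e : ι.onSelfAdjoint ⟨ρ a, by rw [selfAdjoint.mem_iff, ← hρ.map_star, a.2]⟩ =
          hE.onSelfAdjoint N a := Subtype.ext (hN a)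
      rw [e]
      exact (hE.towerSeminorm_onSelfAdjoint_le hβ N a).trans ha
    · change ‖(a : A) - ι (ρ a)‖ ≤ _
      rw [hN]
      exact (towerSeminorm_le_one_iff hβ).1 ha N
  · rwa [towerSeminorm_onSelfAdjoint_of_intertwining hι h]
  · change ‖ι b - ι b‖ ≤ _
    rw [sub_self, norm_zero]
    exact (hβ N).le

end Intertwining

/-! ### Nearby towers on isomorphic algebras -/

section Perturbation

/-- The error at level `n` is measured in units of `β n`, so transporting `a - E 0 a`, of norm at
most `β 0`, raises the seminorm to at most `1 + κ * β 0`. Rescaling only this part and restoring the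
scalar `E 0 a` keeps the displacement below `β 0 * (κ * β 0)`. -/
theorem IsExpectationTower.exists_norm_sub_le_of_perturbation {B B' : Type*} [CStarAlgebra B]
    [CStarAlgebra B'] {E : ℕ → B →L[ℂ] B} (hE : IsExpectationTower E) {E' : ℕ → B' →L[ℂ] B'}
    (hE' : IsExpectationTower E') {e : B →⋆ₐ[ℂ] B'} (he : ∀ b, ‖e b‖ = ‖b‖) {β : ℕ → ℝ}
    (hβ : ∀ n, 0 < β n) {κ : ℝ} (hκ : 0 ≤ κ)
    (h : ∀ n b, ‖e (E n b) - E' n (e b)‖ ≤ κ * β n * ‖b‖) {a : selfAdjoint B}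
    (ha : towerSeminorm E β a ≤ 1) :
    ∃ b : selfAdjoint B', towerSeminorm E' β b ≤ 1 ∧ ‖e (a : B) - b‖ ≤ β 0 * (κ * β 0) := by
  have hβ0 := hβ 0
  set t := κ * β 0 with ht
  have ht0 : 0 ≤ t := by positivity
  rw [towerSeminorm_le_one_iff hβ] at ha
  set a' : selfAdjoint B := a - hE.onSelfAdjoint 0 a with ha'
  have ha'v : (a' : B) = (a : B) - E 0 a := rfl
  have ha'n : ‖(a' : B)‖ ≤ β 0 := ha 0
  obtain ⟨c, hc⟩ := hE.scalar (a : B)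
  refine ⟨(1 + t)⁻¹ • e.onSelfAdjoint a' + e.onSelfAdjoint (hE.onSelfAdjoint 0 a),
    (towerSeminorm_le_one_iff hβ).2 fun n => ?_, ?_⟩
  · have e₁ : (((1 + t)⁻¹ • e.onSelfAdjoint a' + e.onSelfAdjoint (hE.onSelfAdjoint 0 a) :
        selfAdjoint B') : B') = (1 + t)⁻¹ • e a' + algebraMap ℂ B' c := by
      rw [AddSubgroup.coe_add, selfAdjoint.val_smul]
      congr 1
      change e (E 0 a) = _
      rw [hc]
      exact AlgHomClass.commutes e c
    have e₂ : E' n ((1 + t)⁻¹ • e a') = (1 + t)⁻¹ • E' n (e a') :=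
      map_real_smul (E' n) (E' n).continuous _ _
    rw [e₁, map_add, hE'.apply_algebraMap, e₂, add_sub_add_right_eq_sub, ← smul_sub, norm_smul,
      norm_inv, Real.norm_of_nonneg (by positivity), inv_mul_le_iff₀ (by positivity)]
    have e₃ : (a' : B) - E n a' = (a : B) - E n a := by
      rw [ha'v, map_sub, hE.apply_apply_of_ge (Nat.zero_le n)]
      abel
    calc ‖e a' - E' n (e a')‖ = ‖e ((a' : B) - E n a') + (e (E n a') - E' n (e a'))‖ := by
          rw [map_sub]
          congr 1
          abel
      _ ≤ β n + κ * β n * β 0 := by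
          refine (norm_add_le _ _).trans (add_le_add ?_ ((h n _).trans ?_))
          · rw [he, e₃]
            exact ha n
          · exact mul_le_mul_of_nonneg_left ha'n (mul_nonneg hκ (hβ n).le)
      _ = (1 + t) * β n := by
          rw [ht]
          ring
  · have e₁ : e (a : B) - (((1 + t)⁻¹ • e.onSelfAdjoint a' +
        e.onSelfAdjoint (hE.onSelfAdjoint 0 a) : selfAdjoint B') : B') =
        (1 - (1 + t)⁻¹) • e a' := by
      rw [AddSubgroup.coe_add, selfAdjoint.val_smul, sub_smul, one_smul]
      change e (a : B) - ((1 + t)⁻¹ • e a' + e (E 0 a)) = e a' - (1 + t)⁻¹ • e a'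
      rw [ha'v, map_sub]
      abel
    have e₂ : 1 - (1 + t)⁻¹ = t / (1 + t) := by
      field_simp
      ring
    have h₁ : t / (1 + t) ≤ t := div_le_self ht0 (by linarith)
    rw [e₁, norm_smul, he, e₂, Real.norm_of_nonneg (by positivity), mul_comm]
    exact mul_le_mul ha'n h₁ (by positivity) hβ0.le

/-- Both algebras are compared inside `B'`. Since `e` is an isometric isomorphism, its inverse
satisfies the same estimate, so the perturbation argument works in both directions. -/
theorem exists_bridge_length_le_of_perturbation {B B' : Type} [CStarAlgebra B]
    [CStarAlgebra B'] {E : ℕ → B →L[ℂ] B} (hE : IsExpectationTower E) {E' : ℕ → B' →L[ℂ] B'}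
    (hE' : IsExpectationTower E') {e : B →⋆ₐ[ℂ] B'} {f : B' →⋆ₐ[ℂ] B} (hef : ∀ b, e (f b) = b)
    (hfe : ∀ b, f (e b) = b) (hS : (stateSpace B').Nonempty) {β : ℕ → ℝ}
    (hβ : ∀ n, 0 < β n) {κ : ℝ} (hκ : 0 ≤ κ)
    (h : ∀ n b, ‖e (E n b) - E' n (e b)‖ ≤ κ * β n * ‖b‖) :
    ∃ γ : Bridge B B', γ.length (towerSeminorm E β) (towerSeminorm E' β) ≤
      ENNReal.ofReal (β 0 * (κ * β 0)) := by
  have hei : Function.Injective e := Function.LeftInverse.injective hfe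
  have hfi : Function.Injective f := Function.LeftInverse.injective hef
  have he (b : B) : ‖e b‖ = ‖b‖ := NonUnitalStarAlgHom.norm_map e hei b
  have hf (b : B') : ‖f b‖ = ‖b‖ := NonUnitalStarAlgHom.norm_map f hfi b
  have h' (n : ℕ) (b : B') : ‖f (E' n b) - E n (f b)‖ ≤ κ * β n * ‖b‖ := by
    rw [← he, map_sub, hef, norm_sub_rev, ← hf b]
    have := h n (f b)
    rwa [hef] at this
  refine ⟨unitalBridge e (StarAlgHom.id ℂ B') hei Function.injective_id hS,
    length_unitalBridge_le _ _ _ _ _ ?_ ?_ (fun a ha => ?_) (fun b hb => ?_)⟩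
  · refine dualMap_image_stateSpace e ⟨(f : B' →ₗ[ℂ] B),
      AddMonoidHomClass.continuous_of_bound f 1 fun b => by rw [one_mul, hf]⟩ hfe fun a => ⟨f a, ?_⟩
    change f (star a * a) = _
    rw [map_mul, map_star]
  · exact dualMap_image_stateSpace _ (ContinuousLinearMap.id ℂ B') (fun _ => rfl)
      fun a => ⟨a, rfl⟩
  · exact hE.exists_norm_sub_le_of_perturbation hE' he hβ hκ h ha
  · obtain ⟨a, ha, hab⟩ := hE'.exists_norm_sub_le_of_perturbation hE hf hβ hκ h' hb
    refine ⟨a, ha, ?_⟩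
    rw [← he, map_sub, hef, norm_sub_rev] at hab
    exact hab

end Perturbation

/-! ### The expectation tower of an inductive sequence with a faithful trace -/

namespace CStarInductiveSequence

open scoped ComplexOrder

variable (S : CStarInductiveSequence)

theorem Limit.of_map (n : ℕ) (x : S.obj n) : Limit.of S (n + 1) (S.map n x) = Limit.of S n x := by
  have e : S.transition n (n + 1) n.le_succ x = S.map n x := by
    rw [S.transition_succ le_rfl, transition_self]
    rfl
  rw [← e]
  have : PreLimit.of S (n + 1) (S.transition n (n + 1) n.le_succ x) = PreLimit.of S n x :=
    (DirectLimit.eq_of_le (f := S.transition) ⟨n, x⟩ (n + 1) n.le_succ).symm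
  exact congrArg (incl S) this

theorem Limit.of_transition {m n : ℕ} (h : m ≤ n) (x : S.obj m) :
    Limit.of S n (S.transition m n h x) = Limit.of S m x := by
  induction n, h using Nat.le_induction with
  | base => rw [transition_self]; rfl
  | succ n h ih =>
    rw [transition_succ S h]
    exact (Limit.of_map S n _).trans ih

theorem Limit.norm_of (n : ℕ) (x : S.obj n) : ‖Limit.of S n x‖ = ‖x‖ :=
  Limit.norm_incl S _

theorem Limit.isometry_of (n : ℕ) : Isometry (Limit.of S n) :=
  AddMonoidHomClass.isometry_of_norm _ (Limit.norm_of S n)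

theorem Limit.exists_norm_sub_of_lt (a : S.Limit) {ε : ℝ} (hε : 0 < ε) :
    ∃ n x, ‖a - Limit.of S n x‖ < ε := by
  obtain ⟨z, hz⟩ := Metric.denseRange_iff.1 (denseRange_incl S) a ε hε
  obtain ⟨n, x, rfl⟩ := PreLimit.exists_of S z
  exact ⟨n, x, by rwa [← dist_eq_norm]⟩

/-- A tracial state which is faithful on the algebras of the sequence. -/
structure IsFaithfulTrace (μ : WeakDual ℂ S.Limit) : Prop where
  isTracialState : IsTracialState μ
  faithful : ∀ n, IsFaithfulOn (Limit.of S n) μ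

variable {S} {μ : WeakDual ℂ S.Limit}

theorem IsFaithfulTrace.nontrivial (hμ : S.IsFaithfulTrace μ) : Nontrivial S.Limit := by
  refine ⟨1, 0, fun h => ?_⟩
  have := hμ.isTracialState.1.1
  rw [h, map_zero] at this
  exact zero_ne_one this

theorem IsFaithfulTrace.exists_expectation [∀ n, FiniteDimensional ℂ (S.obj n)]
    (hμ : S.IsFaithfulTrace μ) (n : ℕ) :
    ∃ ρ : S.Limit →L[ℂ] S.obj n, IsTracialExpectation (Limit.of S n) μ ρ ∧
      ∀ a, condExpectation (Limit.stage S n) μ a = Limit.of S n (ρ a) := by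
  have := hμ.nontrivial
  obtain ⟨ρ, hρ⟩ := exists_isTracialExpectation hμ.isTracialState (hμ.faithful n)
  exact ⟨ρ, hρ, hρ.condExpectation_apply (Limit.isometry_of S n) (hμ.faithful n)⟩

theorem IsFaithfulTrace.condExpectation_of [∀ n, FiniteDimensional ℂ (S.obj n)]
    (hμ : S.IsFaithfulTrace μ) {m n : ℕ} (h : m ≤ n) (x : S.obj m) :
    condExpectation (Limit.stage S n) μ (Limit.of S m x) = Limit.of S m x := by
  obtain ⟨ρ, hρ, hE⟩ := hμ.exists_expectation n
  rw [hE, ← Limit.of_transition S h, hρ.apply_map]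

theorem IsFaithfulTrace.apply_of_mul_condExpectation [∀ n, FiniteDimensional ℂ (S.obj n)]
    (hμ : S.IsFaithfulTrace μ) {n : ℕ} (x : S.obj n) (a : S.Limit) :
    μ (Limit.of S n x * condExpectation (Limit.stage S n) μ a) = μ (Limit.of S n x * a) := by
  obtain ⟨ρ, hρ, hE⟩ := hμ.exists_expectation n
  rw [hE, ← map_mul (Limit.of S n), ← hρ.map_mul_left, hρ.trace_apply]

/-- For `m ≤ n`, `E m (E n a) = E m a` since both pair equally with stage `m`, which lies in stage
`n`. Convergence holds because the contractions `E n` eventually fix any element of a stage, and the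
stages are dense. -/
theorem IsFaithfulTrace.isExpectationTower [∀ n, FiniteDimensional ℂ (S.obj n)]
    (hμ : S.IsFaithfulTrace μ) (h0 : ∀ x : S.obj 0, ∃ c, x = algebraMap ℂ (S.obj 0) c) :
    IsExpectationTower fun n => condExpectation (Limit.stage S n) μ := by
  choose ρ hρ hE using fun n => hμ.exists_expectation n
  have hle (n : ℕ) (a : S.Limit) : ‖condExpectation (Limit.stage S n) μ a‖ ≤ ‖a‖ := by
    rw [hE, Limit.norm_of]
    exact (hρ n).norm_le a
  refine ⟨hle, fun n a => ?_, fun n => ?_, fun n a b => ?_, fun {m n} h a => ?_, fun {m n} h a => ?_,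
    fun a => ?_, fun n => ?_, fun a => ?_⟩
  · rw [hE, hE, (hρ n).map_star, map_star]
  · have := hμ.condExpectation_of le_rfl (1 : S.obj n)
    rwa [map_one] at this
  · rw [hE n a, hE n b, ← map_mul (Limit.of S n), hμ.condExpectation_of le_rfl]
  · rw [hE m, hE m]
    congr 1
    refine (hμ.faithful m).eq_of_forall_mul fun b => ?_
    rw [map_mul (Limit.of S m), map_mul (Limit.of S m), ← hE, ← hE,
      hμ.apply_of_mul_condExpectation, hμ.apply_of_mul_condExpectation, ← Limit.of_transition S h,
      hμ.apply_of_mul_condExpectation]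
  · rw [hE m, hμ.condExpectation_of h]
  · obtain ⟨c, hc⟩ := h0 (ρ 0 a)
    refine ⟨c, ?_⟩
    rw [hE, hc]
    exact AlgHomClass.commutes (Limit.of S 0) c
  · have : (condExpectation (Limit.stage S n) μ).range ≤
        LinearMap.range (Limit.of S n : S.obj n →ₗ[ℂ] S.Limit) := by
      rintro _ ⟨a, rfl⟩
      exact ⟨ρ n a, (hE n a).symm⟩
    exact Submodule.finiteDimensional_of_le this
  · refine Metric.tendsto_atTop.2 fun ε hε => ?_
    obtain ⟨N, x, hx⟩ := Limit.exists_norm_sub_of_lt S a (half_pos hε)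
    refine ⟨N, fun n hn => ?_⟩
    have e : condExpectation (Limit.stage S n) μ a - a =
        condExpectation (Limit.stage S n) μ (a - Limit.of S N x) - (a - Limit.of S N x) := by
      rw [map_sub, hμ.condExpectation_of hn]
      abel
    rw [dist_eq_norm, e]
    calc _ ≤ ‖a - Limit.of S N x‖ + ‖a - Limit.of S N x‖ :=
          (norm_sub_le _ _).trans (add_le_add (hle n _) le_rfl)
      _ < ε / 2 + ε / 2 := add_lt_add hx hx
      _ = ε := add_halves ε

/-- The maps `E n` of `S.obj N` are the restrictions of the conditional expectations. -/
def IsRestriction (S : CStarInductiveSequence) (μ : WeakDual ℂ S.Limit) (N : ℕ)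
    (E : ℕ → S.obj N →L[ℂ] S.obj N) : Prop :=
  ∀ n b, Limit.of S N (E n b) = condExpectation (Limit.stage S n) μ (Limit.of S N b)

/-- Each expectation preserves stage `N`: for `n ≤ N` it maps into the smaller stage `n`, and for `n
≥ N` it is the identity there. -/
theorem IsFaithfulTrace.exists_isRestriction [∀ n, FiniteDimensional ℂ (S.obj n)]
    (hμ : S.IsFaithfulTrace μ) (N : ℕ) : ∃ E, IsRestriction S μ N E := by
  obtain ⟨ρ, hρ, hE⟩ := hμ.exists_expectation N
  refine ⟨fun n => ρ ∘L condExpectation (Limit.stage S n) μ ∘L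
    ⟨(Limit.of S N : S.obj N →ₗ[ℂ] S.Limit), (Limit.isometry_of S N).continuous⟩, fun n b => ?_⟩
  change Limit.of S N (ρ (condExpectation (Limit.stage S n) μ (Limit.of S N b))) = _
  rcases le_total n N with h | h
  · obtain ⟨ρ', hρ', hE'⟩ := hμ.exists_expectation n
    rw [hE', ← hE, hμ.condExpectation_of h]
  · rw [hμ.condExpectation_of h, ← hE, hμ.condExpectation_of le_rfl]

variable {N : ℕ} {E : ℕ → S.obj N →L[ℂ] S.obj N}

theorem IsRestriction.apply_of_le [∀ n, FiniteDimensional ℂ (S.obj n)] (hE : IsRestriction S μ N E)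
    (hμ : S.IsFaithfulTrace μ) {n : ℕ} (h : N ≤ n) (a : S.obj N) : E n a = a :=
  (Limit.isometry_of S N).injective (by rw [hE, hμ.condExpectation_of h])

theorem IsRestriction.exists_transition [∀ n, FiniteDimensional ℂ (S.obj n)]
    (hE : IsRestriction S μ N E) (hμ : S.IsFaithfulTrace μ) {n : ℕ} (h : n ≤ N) (a : S.obj N) :
    ∃ x, E n a = S.transition n N h x := by
  obtain ⟨ρ, hρ, hE'⟩ := hμ.exists_expectation n
  exact ⟨_, (Limit.isometry_of S N).injective (by rw [hE, hE', Limit.of_transition])⟩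

theorem IsRestriction.apply_transition_mul [∀ n, FiniteDimensional ℂ (S.obj n)]
    (hE : IsRestriction S μ N E) (hμ : S.IsFaithfulTrace μ) {n : ℕ} (h : n ≤ N) (x : S.obj n)
    (a : S.obj N) : μ (Limit.of S N (S.transition n N h x * E n a)) =
      μ (Limit.of S N (S.transition n N h x * a)) := by
  rw [map_mul (Limit.of S N), hE, Limit.of_transition, hμ.apply_of_mul_condExpectation,
    map_mul (Limit.of S N), Limit.of_transition]

theorem IsRestriction.isExpectationTower [∀ n, FiniteDimensional ℂ (S.obj n)]
    (hE : IsRestriction S μ N E) (hμ : S.IsFaithfulTrace μ)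
    (h0 : ∀ x : S.obj 0, ∃ c, x = algebraMap ℂ (S.obj 0) c) : IsExpectationTower E :=
  (hμ.isExpectationTower h0).of_intertwining (Limit.isometry_of S N) hE

theorem IsRestriction.exists_bridge_length_le [∀ n, FiniteDimensional ℂ (S.obj n)]
    (hE : IsRestriction S μ N E) (hμ : S.IsFaithfulTrace μ)
    (h0 : ∀ x : S.obj 0, ∃ c, x = algebraMap ℂ (S.obj 0) c) {β : ℕ → ℝ} (hβ : ∀ n, 0 < β n) :
    ∃ γ : Bridge S.Limit (S.obj N), γ.length (S.lipNorm μ β) (towerSeminorm E β) ≤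
      ENNReal.ofReal (β N) := by
  obtain ⟨ρ, hρ, hE'⟩ := hμ.exists_expectation N
  exact exists_bridge_length_le_of_intertwining (hμ.isExpectationTower h0) (Limit.isometry_of S N)
    hE hβ hμ.isTracialState.1 hρ fun a => (hE' a).symm

/-- The function `‖μ (star x * x)‖` is homogeneous of degree 2 and, by faithfulness, positive on the
compact unit sphere; `c` is its minimum there. -/
theorem IsFaithfulTrace.exists_le_apply_star_mul_self [∀ n, FiniteDimensional ℂ (S.obj n)]
    (hμ : S.IsFaithfulTrace μ) (N : ℕ) :
    ∃ c > 0, ∀ x : S.obj N, c * ‖x‖ ^ 2 ≤ ‖μ (Limit.of S N (star x * x))‖ := by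
  have : ProperSpace (S.obj N) := FiniteDimensional.proper ℂ _
  set f : S.obj N → ℝ := fun x => ‖μ (Limit.of S N (star x * x))‖ with hf
  have hfc : Continuous f := by
    refine (Continuous.comp (ContinuousLinearMap.continuous (WeakDual.toStrongDual μ)) ?_).norm
    exact (Limit.isometry_of S N).continuous.comp (continuous_star.mul continuous_id)
  have hfs (t : ℝ) (x : S.obj N) : f (t • x) = t ^ 2 * f x := by
    have e : star (t • x) * (t • x) = ((t : ℂ) ^ 2) • (star x * x) := by
      rw [star_smul, star_trivial, smul_mul_smul_comm, ← sq]
      exact (by norm_cast : ((t ^ 2 : ℝ) : ℂ) = (t : ℂ) ^ 2) ▸ (Complex.coe_smul _ _).symm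
    simp only [hf]
    rw [e, map_smul, map_smul, smul_eq_mul, norm_mul, norm_pow, Complex.norm_real,
      Real.norm_eq_abs, sq_abs]
  rcases (Metric.sphere (0 : S.obj N) 1).eq_empty_or_nonempty with h | h
  -- An empty sphere means that the stage is the zero algebra, so any constant works.
  · refine ⟨1, one_pos, fun x => ?_⟩
    have hx : x = 0 := by
      by_contra hx
      have : ‖x‖⁻¹ • x ∈ Metric.sphere (0 : S.obj N) 1 := by
        rw [mem_sphere_zero_iff_norm, norm_smul, norm_inv, norm_norm,
          inv_mul_cancel₀ (norm_ne_zero_iff.2 hx)]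
      rw [h] at this
      exact this
    rw [hx, norm_zero]
    simp
  · obtain ⟨y, hy, hmin⟩ := (isCompact_sphere (0 : S.obj N) 1).exists_isMinOn h hfc.continuousOn
    rw [mem_sphere_zero_iff_norm] at hy
    refine ⟨f y, norm_pos_iff.2 fun h => ?_, fun x => ?_⟩
    · have := hμ.faithful N y h
      rw [this, norm_zero] at hy
      exact zero_ne_one hy
    · rcases eq_or_ne x 0 with rfl | hx
      · rw [norm_zero]
        simp
      · have hx' := norm_ne_zero_iff.2 hx
        have : ‖x‖⁻¹ • x ∈ Metric.sphere (0 : S.obj N) 1 := by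
          rw [mem_sphere_zero_iff_norm, norm_smul, norm_inv, norm_norm, inv_mul_cancel₀ hx']
        have h₁ : f y ≤ f (‖x‖⁻¹ • x) := hmin this
        rw [hfs, inv_pow, ← div_eq_inv_mul, le_div_iff₀ (by positivity)] at h₁
        exact h₁

/-- Close traces have close conditional expectations. -/
theorem IsRestriction.norm_sub_le [∀ n, FiniteDimensional ℂ (S.obj n)]
    {S' : CStarInductiveSequence} [∀ n, FiniteDimensional ℂ (S'.obj n)] {μ' : WeakDual ℂ S'.Limit}
    {E' : ℕ → S'.obj N →L[ℂ] S'.obj N} (hE : IsRestriction S μ N E) (hμ : S.IsFaithfulTrace μ)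
    (hE' : IsRestriction S' μ' N E') (hμ' : S'.IsFaithfulTrace μ')
    (hle' : ∀ n a, ‖E' n a‖ ≤ ‖a‖)
    {e : S.obj N →⋆ₐ[ℂ] S'.obj N} (he : ∀ b, ‖e b‖ = ‖b‖)
    (h₁ : ∀ n (h : n ≤ N) x, ∃ y, e (S.transition n N h x) = S'.transition n N h y)
    (h₂ : ∀ n (h : n ≤ N) y, ∃ x, e (S.transition n N h x) = S'.transition n N h y)
    {c δ : ℝ} (hc : 0 < c) (hδ : 0 ≤ δ)
    (hcμ : ∀ x : S.obj N, c * ‖x‖ ^ 2 ≤ ‖μ (Limit.of S N (star x * x))‖)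
    (hμμ' : ∀ x, ‖μ (Limit.of S N x) - μ' (Limit.of S' N (e x))‖ ≤ δ * ‖x‖) (n : ℕ) (a : S.obj N) :
    ‖e (E n a) - E' n (e a)‖ ≤ 2 * δ / c * ‖a‖ := by
  rcases le_total N n with h | h
  · rw [hE.apply_of_le hμ h, hE'.apply_of_le hμ' h, sub_self, norm_zero]
    positivity
  obtain ⟨p, hp⟩ := hE.exists_transition hμ h a
  obtain ⟨q', hq'⟩ := hE'.exists_transition hμ' h (e a)
  obtain ⟨q, hq⟩ := h₂ n h q'
  set Q := S.transition n N h q with hQ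
  -- `Q` is the second expectation of `e a` pulled back along `e`. By `h₂` it lies in stage `n`, so
  -- `d = E n a - Q` does too and can be tested against the first expectation.
  set d := S.transition n N h (p - q) with hd
  have hdPQ : d = E n a - Q := by rw [hd, map_sub, hp]
  have heQ : e Q = E' n (e a) := by rw [hq, hq']
  -- `e (star d)` lies in stage `n` of the second sequence, hence is a legitimate test element for
  -- `E' n`.
  obtain ⟨y, hy⟩ := h₁ n h (star (p - q))
  have hQa : ‖Q‖ ≤ ‖a‖ := by
    rw [← he, heQ, ← he a]
    exact hle' n _
  have k₁ : μ (Limit.of S N (star d * E n a)) = μ (Limit.of S N (star d * a)) := by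
    rw [hd, ← map_star]
    exact hE.apply_transition_mul hμ h _ a
  have k₂ : μ' (Limit.of S' N (e (star d * Q))) = μ' (Limit.of S' N (e (star d * a))) := by
    rw [map_mul e, map_mul e, hd, ← map_star (S.transition n N h), hy, heQ]
    exact hE'.apply_transition_mul hμ' h _ _
  have k₃ : star d * d = star d * E n a - star d * Q := by rw [hdPQ, mul_sub]
  -- Both expectations drop out against `star d`; what remains are two discrepancies between the
  -- traces, each at most `δ * ‖d‖ * ‖a‖`.
  have k₄ : μ (Limit.of S N (star d * d)) =
      (μ (Limit.of S N (star d * a)) - μ' (Limit.of S' N (e (star d * a)))) -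
      (μ (Limit.of S N (star d * Q)) - μ' (Limit.of S' N (e (star d * Q)))) := by
    rw [k₃, map_sub, map_sub, k₁, k₂]
    ring
  have k₅ : c * ‖d‖ ^ 2 ≤ 2 * δ * ‖a‖ * ‖d‖ := by
    have hb {x : S.obj N} (hx : ‖x‖ ≤ ‖a‖) : δ * ‖star d * x‖ ≤ δ * (‖d‖ * ‖a‖) := by
      refine mul_le_mul_of_nonneg_left ((norm_mul_le _ _).trans ?_) hδ
      rw [norm_star]
      exact mul_le_mul_of_nonneg_left hx (norm_nonneg _)
    calc c * ‖d‖ ^ 2 ≤ _ := hcμ d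
      _ ≤ δ * ‖star d * a‖ + δ * ‖star d * Q‖ := by
          rw [k₄]
          exact (_root_.norm_sub_le _ _).trans (add_le_add (hμμ' _) (hμμ' _))
      _ ≤ δ * (‖d‖ * ‖a‖) + δ * (‖d‖ * ‖a‖) := add_le_add (hb le_rfl) (hb hQa)
      _ = _ := by ring
  rw [← heQ, ← map_sub, he, ← hdPQ, div_mul_eq_mul_div, le_div_iff₀ hc, mul_comm]
  rcases (norm_nonneg d).eq_or_lt with h0 | h0
  · rw [← h0, mul_zero]
    positivity
  · rw [sq, ← mul_assoc] at k₅
    exact le_of_mul_le_mul_right k₅ h0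

end CStarInductiveSequence

/-! ### Continued fractions with prescribed digits -/

section ContinuedFractions

/-- `y n = [0; r (n + 1), r (n + 2), …]`. -/
structure IsContinuedFractionTail (r : ℕ → ℕ) (y : ℕ → ℝ) : Prop where
  mem_Icc : ∀ n, y n ∈ Set.Icc (0 : ℝ) 1
  mul_eq_one : ∀ n, y n * (r (n + 1) + y (n + 1)) = 1

/-- Solve the first `n` equations backwards: given a solution for the shifted digits, prepend `(r 1
+ y 0)⁻¹`. -/
theorem exists_continuedFraction_approx (n : ℕ) (r : ℕ → ℕ) (hr : ∀ n, 1 ≤ r (n + 1)) :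
    ∃ y : ℕ → ℝ, (∀ n, y n ∈ Set.Icc (0 : ℝ) 1) ∧
      ∀ m < n, y m * (r (m + 1) + y (m + 1)) = 1 := by
  induction n generalizing r with
  | zero => exact ⟨0, fun n => ⟨le_rfl, zero_le_one⟩, fun m hm => absurd hm (Nat.not_lt_zero m)⟩
  | succ n ih =>
    obtain ⟨y, hy, h⟩ := ih (fun k => r (k + 1)) fun k => hr (k + 1)
    have h0 := (hy 0).1
    have h1 : (1 : ℝ) ≤ r 1 := by exact_mod_cast hr 0
    have hp : (1 : ℝ) ≤ r 1 + y 0 := by linarith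
    refine ⟨fun k => Nat.casesOn k (r 1 + y 0)⁻¹ y, fun k => ?_, fun m hm => ?_⟩
    · cases k with
      | zero => exact ⟨inv_nonneg.2 (by linarith), inv_le_one_of_one_le₀ hp⟩
      | succ k => exact hy k
    · cases m with
      | zero => exact inv_mul_cancel₀ (by linarith)
      | succ m => exact h m (Nat.lt_of_succ_lt_succ hm)

/-- The solutions of the first `n` equations form nested nonempty compact subsets of the cube, so
they have a common point; convergence of the convergents is not needed. -/
theorem exists_isContinuedFractionTail (r : ℕ → ℕ) (hr : ∀ n, 1 ≤ r (n + 1)) :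
    ∃ y, IsContinuedFractionTail r y := by
  let K : Set (ℕ → ℝ) := Set.pi Set.univ fun _ => Set.Icc (0 : ℝ) 1
  have hK : IsCompact K := isCompact_univ_pi fun _ => isCompact_Icc
  let F : ℕ → Set (ℕ → ℝ) := fun n => K ∩ {y | ∀ m < n, y m * (r (m + 1) + y (m + 1)) = 1}
  have hF (n : ℕ) : IsClosed {y : ℕ → ℝ | ∀ m < n, y m * (r (m + 1) + y (m + 1)) = 1} := by
    simp only [Set.ofPred_forall]
    refine isClosed_iInter fun m => isClosed_iInter fun _ => isClosed_eq ?_ continuous_const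
    exact (continuous_apply m).mul (continuous_const.add (continuous_apply (m + 1)))
  obtain ⟨y, hy⟩ := IsCompact.nonempty_iInter_of_sequence_nonempty_isCompact_isClosed F
    (fun n y hy => ⟨hy.1, fun m hm => hy.2 m (hm.trans n.lt_succ_self)⟩)
    (fun n => by
      obtain ⟨y, hy, h⟩ := exists_continuedFraction_approx n r hr
      exact ⟨y, fun m _ => hy m, h⟩)
    (hK.inter_right (hF 0)) fun n => hK.isClosed.inter (hF n)
  rw [Set.mem_iInter] at hy
  exact ⟨y, fun n => (hy 0).1 n trivial, fun n => (hy (n + 1)).2 n n.lt_succ_self⟩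

namespace IsContinuedFractionTail

variable {r : ℕ → ℕ} {y : ℕ → ℝ}

theorem pos (h : IsContinuedFractionTail r y) (n : ℕ) : 0 < y n :=
  (h.mem_Icc n).1.lt_of_ne fun h0 => by
    have := h.mul_eq_one n
    rw [← h0, zero_mul] at this
    exact zero_ne_one this

theorem inv_eq (h : IsContinuedFractionTail r y) (n : ℕ) : (y n)⁻¹ = r (n + 1) + y (n + 1) :=
  inv_eq_of_mul_eq_one_right (h.mul_eq_one n)

theorem lt_one (h : IsContinuedFractionTail r y) (hr : ∀ n, 1 ≤ r (n + 1)) (n : ℕ) : y n < 1 := by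
  have h1 : (1 : ℝ) ≤ r (n + 1) := by exact_mod_cast hr n
  rw [← inv_inv (y n), h.inv_eq]
  exact inv_lt_one_of_one_lt₀ (by linarith [h.pos (n + 1)])

theorem fract_inv (h : IsContinuedFractionTail r y) (hr : ∀ n, 1 ≤ r (n + 1)) (n : ℕ) :
    Int.fract (y n)⁻¹ = y (n + 1) := by
  rw [h.inv_eq, Int.fract_natCast_add, Int.fract_eq_self]
  exact ⟨(h.pos _).le, h.lt_one hr _⟩

theorem floor_inv (h : IsContinuedFractionTail r y) (hr : ∀ n, 1 ≤ r (n + 1)) (n : ℕ) :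
    ⌊(y n)⁻¹⌋ = r (n + 1) := by
  rw [h.inv_eq, Int.floor_natCast_add, Int.floor_eq_zero_iff.2 ⟨(h.pos _).le, h.lt_one hr _⟩,
    add_zero]

/-- Stated for every `v` with fractional part `y m`, because one step of the algorithm replaces `v`
by the inverse of its fractional part, whose own fractional part is `y (m + 1)`. -/
theorem get?_of (h : IsContinuedFractionTail r y) (hr : ∀ n, 1 ≤ r (n + 1)) (n m : ℕ) (v : ℝ)
    (hv : Int.fract v = y m) :
    (GenContFract.of v).s.get? n = some ⟨1, (r (m + n + 1) : ℝ)⟩ := by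
  induction n generalizing m v with
  | zero =>
    have := GenContFract.of_s_head (v := v) (by rw [hv]; exact (h.pos m).ne')
    rw [hv, h.floor_inv hr] at this
    exact this
  | succ n ih =>
    rw [GenContFract.of_s_succ, ih (m + 1) _ (by rw [hv, h.fract_inv hr])]
    congr 4
    ring

theorem cfDigit_succ (h : IsContinuedFractionTail r y) (hr : ∀ n, 1 ≤ r (n + 1)) (n : ℕ) :
    cfDigit (y 0) (n + 1) = r (n + 1) := by
  have hg := h.get?_of hr n 0 (y 0) (Int.fract_eq_self.2 ⟨(h.pos 0).le, h.lt_one hr 0⟩)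
  have : (GenContFract.of (y 0)).partDens.get? n = some (r (0 + n + 1) : ℝ) := by
    rw [GenContFract.partDens, Stream'.Seq.map_get?, hg]
    rfl
  rw [cfDigit, this, Option.getD_some, Nat.floor_natCast, zero_add]

/-- A rational number has a terminating expansion, whereas here every digit exists. -/
theorem irrational (h : IsContinuedFractionTail r y) (hr : ∀ n, 1 ≤ r (n + 1)) :
    Irrational (y 0) := by
  rintro ⟨a, ha⟩
  obtain ⟨n, hn⟩ := (GenContFract.terminates_iff_rat (y 0)).2 ⟨a, ha.symm⟩
  have hg := h.get?_of hr n 0 (y 0) (Int.fract_eq_self.2 ⟨(h.pos 0).le, h.lt_one hr 0⟩)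
  have hn : (GenContFract.of (y 0)).s.get? n = none := hn
  rw [hg] at hn
  exact Option.some_ne_none _ hn

end IsContinuedFractionTail

theorem exists_mem_Ioo_cfDigit_eq (r : ℕ → ℕ) (hr0 : r 0 = 0) (hr : ∀ n, 1 ≤ r (n + 1)) :
    ∃ θ : ℝ, Irrational θ ∧ θ ∈ Set.Ioo 0 1 ∧ cfDigit θ = r := by
  obtain ⟨y, hy⟩ := exists_isContinuedFractionTail r hr
  refine ⟨y 0, hy.irrational hr, ⟨hy.pos 0, hy.lt_one hr 0⟩, funext fun n => ?_⟩
  cases n with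
  | zero => rw [cfDigit, hr0, Nat.floor_eq_zero.2 (hy.lt_one hr 0)]
  | succ n => exact hy.cfDigit_succ hr n

end ContinuedFractions

/-! ### Trace weights -/

namespace EffrosShen

/-- `x (n + 1)` and `x (n + 2)` are the values of a tracial state at the minimal projections of the
two summands of the stage `n + 1`. -/
structure IsTraceWeight (r : ℕ → ℕ) (x : ℕ → ℝ) : Prop where
  zero : x 0 = 1
  nonneg : ∀ n, 0 ≤ x n
  eq_add : ∀ n, x n = r (n + 1) * x (n + 1) + x (n + 2)

/-- Take partial products of the tails `y i`; the recursion is the tail equation multiplied by such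
a product. -/
theorem exists_isTraceWeight (r : ℕ → ℕ) (hr : ∀ n, 1 ≤ r (n + 1)) : ∃ x, IsTraceWeight r x := by
  obtain ⟨y, hy⟩ := exists_isContinuedFractionTail r hr
  refine ⟨fun n => ∏ i ∈ Finset.range n, y i, Finset.prod_range_zero _,
    fun n => Finset.prod_nonneg fun i _ => (hy.pos i).le, fun n => ?_⟩
  simp only [Finset.prod_range_succ]
  linear_combination -(∏ i ∈ Finset.range n, y i) * hy.mul_eq_one n

theorem le_q (r : ℕ → ℕ) (hr : ∀ n, 1 ≤ r (n + 1)) (n : ℕ) : n ≤ q r n ∧ 1 ≤ q r n := by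
  induction n using Nat.twoStepInduction with
  | zero => exact ⟨Nat.zero_le _, le_rfl⟩
  | one => exact ⟨hr 0, hr 0⟩
  | more n h₁ h₂ =>
    have : q r (n + 1) ≤ r (n + 2) * q r (n + 1) := Nat.le_mul_of_pos_left _ (hr (n + 1))
    change n + 2 ≤ r (n + 2) * q r (n + 1) + q r n ∧ 1 ≤ r (n + 2) * q r (n + 1) + q r n
    omega

theorem q_congr {r r' : ℕ → ℕ} {n : ℕ} (h : ∀ i ≤ n, r i = r' i) : q r n = q r' n := by
  induction n using Nat.twoStepInduction with
  | zero => rfl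
  | one => exact h 1 le_rfl
  | more n h₁ h₂ =>
    change r (n + 2) * q r (n + 1) + q r n = r' (n + 2) * q r' (n + 1) + q r' n
    rw [h₁ fun i hi => h i (by omega), h₂ fun i hi => h i (by omega), h (n + 2) le_rfl]

namespace IsTraceWeight

variable {r : ℕ → ℕ} {x : ℕ → ℝ}

/-- The left side is the trace of the unit of stage `n + 1`, which the recursions for `q` and `x`
keep constant. -/
theorem q_mul_add (hx : IsTraceWeight r x) (n : ℕ) :
    q r (n + 1) * x (n + 1) + q r n * x (n + 2) = 1 := by
  induction n with
  | zero =>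
    have h₁ : q r 1 = r 1 := rfl
    have h₀ : q r 0 = 1 := rfl
    have := hx.eq_add 0
    rw [hx.zero] at this
    rw [zero_add, h₁, h₀, this]
    simp
  | succ n ih =>
    have h : q r (n + 2) = r (n + 2) * q r (n + 1) + q r n := rfl
    rw [← ih, h, hx.eq_add (n + 1)]
    push_cast
    ring

/-- A zero weight would force the next two to vanish, contradicting the normalisation. -/
theorem pos (hx : IsTraceWeight r x) (hr : ∀ n, 1 ≤ r (n + 1)) (n : ℕ) : 0 < x n := by
  refine (hx.nonneg n).lt_of_ne fun h0 => ?_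
  have h := hx.eq_add n
  have h1 : (1 : ℝ) ≤ r (n + 1) := by exact_mod_cast hr n
  have := hx.nonneg (n + 1)
  have := hx.nonneg (n + 2)
  have e₁ : x (n + 1) = 0 := by nlinarith
  have e₂ : x (n + 2) = 0 := by
    rw [← h0, e₁] at h
    linarith
  have := hx.q_mul_add n
  rw [e₁, e₂] at this
  simp at this

theorem le_one (hx : IsTraceWeight r x) (hr : ∀ n, 1 ≤ r (n + 1)) (n : ℕ) : x n ≤ 1 := by
  induction n with
  | zero => exact hx.zero.le
  | succ n ih =>
    have h := hx.eq_add n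
    have h1 : (1 : ℝ) ≤ r (n + 1) := by exact_mod_cast hr n
    have := hx.nonneg (n + 1)
    have := hx.nonneg (n + 2)
    nlinarith

/-- While the digits agree, the difference satisfies the same linear recursion and starts from 0, so
it is a multiple of the solution `(-1) ^ n * q r n`. -/
theorem sub_eq_mul {r' : ℕ → ℕ} {x' : ℕ → ℝ} (hx : IsTraceWeight r x) (hx' : IsTraceWeight r' x')
    {N : ℕ} (h : ∀ i ≤ N, r i = r' i) {n : ℕ} (hn : n ≤ N) :
    x (n + 1) - x' (n + 1) = (-1) ^ n * q r n * (x 1 - x' 1) := by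
  induction n using Nat.twoStepInduction with
  | zero =>
    have h₀ : q r 0 = 1 := rfl
    rw [h₀]
    simp
  | one =>
    have h₁ : q r 1 = r 1 := rfl
    have e := hx.eq_add 0
    have e' := hx'.eq_add 0
    rw [hx.zero] at e
    rw [hx'.zero, ← h 1 hn] at e'
    rw [h₁]
    linear_combination e' - e
  | more n h₁ h₂ =>
    have hq : q r (n + 2) = r (n + 2) * q r (n + 1) + q r n := rfl
    have e := hx.eq_add (n + 1)
    have e' := hx'.eq_add (n + 1)
    rw [← h (n + 2) hn] at e'
    rw [hq]
    push_cast
    linear_combination e' - e + h₁ (by omega) - (r (n + 2) : ℝ) * h₂ (by omega)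

/-- At the last common index the difference is at most 1, as both weights lie in [0, 1]; dividing by
`q r (N + 1) ≥ N + 1` bounds `|x 1 - x' 1|`, and the proportionality carries this to every earlier
index. -/
theorem abs_sub_le {r' : ℕ → ℕ} {x' : ℕ → ℝ} (hx : IsTraceWeight r x) (hx' : IsTraceWeight r' x')
    (hr : ∀ n, 1 ≤ r (n + 1)) (hr' : ∀ n, 1 ≤ r' (n + 1))
    {N : ℕ} (h : ∀ i ≤ N + 1, r i = r' i) {n : ℕ} (hn : n ≤ N + 1) :
    |x (n + 1) - x' (n + 1)| ≤ q r n / (N + 1) := by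
  have hN := hx.sub_eq_mul hx' h le_rfl
  have hNq : ((N + 1 : ℕ) : ℝ) ≤ q r (N + 1) := by exact_mod_cast (le_q r hr (N + 1)).1
  push_cast at hNq
  have h1 : |x (N + 1 + 1) - x' (N + 1 + 1)| ≤ 1 := by
    rw [abs_le]
    constructor <;> linarith [hx.nonneg (N + 1 + 1), hx'.nonneg (N + 1 + 1), hx.le_one hr (N + 1 + 1),
      hx'.le_one hr' (N + 1 + 1)]
  have hδ : |x 1 - x' 1| * (N + 1) ≤ 1 := by
    rw [hN, abs_mul, abs_mul, abs_pow, abs_neg, abs_one, one_pow, one_mul, Nat.abs_cast] at h1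
    nlinarith [abs_nonneg (x 1 - x' 1)]
  rw [hx.sub_eq_mul hx' h hn, abs_mul, abs_mul, abs_pow, abs_neg, abs_one, one_pow, one_mul,
    Nat.abs_cast, le_div_iff₀ (by positivity), mul_assoc]
  exact mul_le_of_le_one_right (Nat.cast_nonneg _) hδ

end IsTraceWeight

end EffrosShen

/-! ### Weighted traces on the stages -/

namespace EffrosShen

open scoped Matrix.Norms.L2Operator ComplexOrder

theorem norm_apply_le_norm {p : ℕ} (a : Matrix (Fin p) (Fin p) ℂ) (i j : Fin p) :
    ‖a i j‖ ≤ ‖a‖ := by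
  have h := Matrix.l2_opNorm_mulVec a (EuclideanSpace.single j 1)
  rw [PiLp.norm_single, norm_one, mul_one] at h
  refine le_trans ?_ h
  refine le_trans (le_of_eq ?_) (PiLp.norm_apply_le _ i)
  simp

theorem norm_trace_le {p : ℕ} (a : Matrix (Fin p) (Fin p) ℂ) : ‖a.trace‖ ≤ p * ‖a‖ := by
  refine (norm_sum_le _ _).trans ((Finset.sum_le_sum fun i _ => norm_apply_le_norm a i i).trans ?_)
  simp

theorem trace_blockMatrix (m : ℕ) {p s : ℕ} (a : Matrix (Fin p) (Fin p) ℂ)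
    (b : Matrix (Fin s) (Fin s) ℂ) : (blockMatrix m a b).trace = m * a.trace + b.trace := by
  have h (M : Matrix ((Fin p × Fin m) ⊕ Fin s) ((Fin p × Fin m) ⊕ Fin s) ℂ) :
      (Matrix.reindexAlgEquiv ℂ ℂ (blockEquiv m p s) M).trace = M.trace := by
    rw [Matrix.coe_reindexAlgEquiv]
    exact Equiv.sum_comp (blockEquiv m p s).symm fun i => M i i
  rw [blockMatrix, h, Matrix.trace, Fintype.sum_sum_type]
  have e := Matrix.trace_blockDiagonal fun _ : Fin m => a
  rw [Finset.sum_const, Finset.card_univ, Fintype.card_fin, nsmul_eq_mul] at e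
  rw [← e]
  rfl

/-- Swap the factors in `E_kl = E_ki E_il`: off-diagonal units get the value 0 and all diagonal ones
the same value. -/
theorem eq_mul_trace {p : ℕ} (τ : Matrix (Fin p) (Fin p) ℂ →ₗ[ℂ] ℂ)
    (hτ : ∀ a b, τ (a * b) = τ (b * a)) (i : Fin p) (a : Matrix (Fin p) (Fin p) ℂ) :
    τ a = τ (Matrix.single i i 1) * a.trace := by
  have h (k l : Fin p) : τ (Matrix.single k l 1) = if k = l then τ (Matrix.single i i 1) else 0 := by
    have e : Matrix.single k l (1 : ℂ) = Matrix.single k i 1 * Matrix.single i l 1 := by simp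
    rw [e, hτ]
    split_ifs with hkl
    · subst hkl
      simp
    · rw [Matrix.single_mul_single_of_ne (h := Ne.symm hkl), map_zero]
  have ha := Matrix.matrix_eq_sum_single a
  have hs (k l : Fin p) : Matrix.single k l (a k l) = a k l • Matrix.single k l (1 : ℂ) := by simp
  calc τ a = ∑ k, ∑ l, a k l * (if k = l then τ (Matrix.single i i 1) else 0) := by
        conv_lhs => rw [ha]
        rw [map_sum]
        refine Finset.sum_congr rfl fun k _ => ?_
        rw [map_sum]
        refine Finset.sum_congr rfl fun l _ => ?_
        rw [hs, map_smul, h, smul_eq_mul]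
    _ = ∑ k, a k k * τ (Matrix.single i i 1) := by
        simp only [mul_ite, mul_zero, Finset.sum_ite_eq, Finset.mem_univ, if_true]
    _ = _ := by
        rw [← Finset.sum_mul, mul_comm]
        rfl

/-- The linear functional `a ⊕ b ↦ u tr(a) + v tr(b)`. -/
def weightedTrace (p s : ℕ) (u v : ℝ) :
    (Matrix (Fin p) (Fin p) ℂ × Matrix (Fin s) (Fin s) ℂ) →ₗ[ℂ] ℂ where
  toFun a := u * a.1.trace + v * a.2.trace
  map_add' a b := by
    rw [Prod.fst_add, Prod.snd_add, Matrix.trace_add, Matrix.trace_add]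
    ring
  map_smul' c a := by
    rw [Prod.smul_fst, Prod.smul_snd, Matrix.trace_smul, Matrix.trace_smul, RingHom.id_apply,
      smul_eq_mul, smul_eq_mul, smul_eq_mul]
    ring

/-- The trace with weights `x` on the stages of the Effros–Shen sequence. -/
def stageTrace (r : ℕ → ℕ) (x : ℕ → ℝ) : (n : ℕ) → Stage r n →ₗ[ℂ] ℂ
  | 0 => (LinearMap.id : ℂ →ₗ[ℂ] ℂ)
  | n + 1 => weightedTrace (q r (n + 1)) (q r n) (x (n + 1)) (x (n + 2))

instance (r : ℕ → ℕ) : (n : ℕ) → FiniteDimensional ℂ (Stage r n)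
  | 0 => inferInstanceAs (FiniteDimensional ℂ ℂ)
  | n + 1 => inferInstanceAs (FiniteDimensional ℂ
      (Matrix (Fin (q r (n + 1))) (Fin (q r (n + 1))) ℂ × Matrix (Fin (q r n)) (Fin (q r n)) ℂ))

instance (r : ℕ → ℕ) (n : ℕ) : FiniteDimensional ℂ ((sequence r).obj n) :=
  inferInstanceAs (FiniteDimensional ℂ (Stage r n))

variable {r : ℕ → ℕ} {x : ℕ → ℝ}

theorem stageTrace_succ_apply (n : ℕ) (a : Stage r (n + 1)) :
    stageTrace r x (n + 1) a = x (n + 1) * a.1.trace + x (n + 2) * a.2.trace := rfl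

theorem IsTraceWeight.stageTrace_one (hx : IsTraceWeight r x) (n : ℕ) :
    stageTrace r x n 1 = 1 := by
  cases n with
  | zero => rfl
  | succ n =>
    rw [stageTrace_succ_apply]
    change (x (n + 1) : ℂ) * (1 : Matrix (Fin (q r (n + 1))) (Fin (q r (n + 1))) ℂ).trace +
      x (n + 2) * (1 : Matrix (Fin (q r n)) (Fin (q r n)) ℂ).trace = 1
    rw [Matrix.trace_one, Matrix.trace_one, Fintype.card_fin, Fintype.card_fin]
    have := hx.q_mul_add n
    rw [mul_comm, mul_comm (q r n : ℝ)] at this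
    exact_mod_cast this

theorem IsTraceWeight.stageTrace_map (hx : IsTraceWeight r x) (n : ℕ) (a : Stage r n) :
    stageTrace r x (n + 1) ((sequence r).map n a) = stageTrace r x n a := by
  cases n with
  | zero =>
    have h : (sequence r).map 0 a = (show ℂ from a) • (1 : Stage r 1) :=
      Algebra.algebraMap_eq_smul_one (A := Stage r 1) (show ℂ from a)
    rw [h, map_smul, hx.stageTrace_one, smul_eq_mul, mul_one]
    rfl
  | succ n =>
    change (x (n + 2) : ℂ) * (blockMatrix (r (n + 2)) a.1 a.2).trace + x (n + 3) * a.1.trace =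
      x (n + 1) * a.1.trace + x (n + 2) * a.2.trace
    rw [trace_blockMatrix, hx.eq_add (n + 1)]
    push_cast
    ring

theorem stageTrace_mul_comm (n : ℕ) (a b : Stage r n) :
    stageTrace r x n (a * b) = stageTrace r x n (b * a) := by
  cases n with
  | zero => exact congrArg (stageTrace r x 0) (mul_comm (show ℂ from a) (show ℂ from b))
  | succ n =>
    change (x (n + 1) : ℂ) * (a.1 * b.1).trace + x (n + 2) * (a.2 * b.2).trace =
      x (n + 1) * (b.1 * a.1).trace + x (n + 2) * (b.2 * a.2).trace
    rw [Matrix.trace_mul_comm a.1, Matrix.trace_mul_comm a.2]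

theorem stageTrace_star_mul_self_nonneg (hx : ∀ n, 0 ≤ x n) (n : ℕ) (a : Stage r n) :
    0 ≤ stageTrace r x n (star a * a) := by
  cases n with
  | zero => exact star_mul_self_nonneg (show ℂ from a)
  | succ n =>
    have h (n : ℕ) : (0 : ℂ) ≤ x n := by exact_mod_cast hx n
    change 0 ≤ (x (n + 1) : ℂ) * (Matrix.conjTranspose a.1 * a.1).trace +
      x (n + 2) * (Matrix.conjTranspose a.2 * a.2).trace
    exact add_nonneg
      (mul_nonneg (h _) (Matrix.posSemidef_conjTranspose_mul_self _).trace_nonneg)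
      (mul_nonneg (h _) (Matrix.posSemidef_conjTranspose_mul_self _).trace_nonneg)

theorem eq_zero_of_stageTrace_star_mul_self (hx : ∀ n, 0 < x n) (n : ℕ) (a : Stage r n)
    (h0 : stageTrace r x n (star a * a) = 0) : a = 0 := by
  cases n with
  | zero => exact (CStarRing.star_mul_self_eq_zero_iff (show ℂ from a)).1 h0
  | succ n =>
    have h (n : ℕ) : (0 : ℂ) ≤ x n := by exact_mod_cast (hx n).le
    have hne (n : ℕ) : (x n : ℂ) ≠ 0 := by exact_mod_cast (hx n).ne'
    have h0 : (x (n + 1) : ℂ) * (Matrix.conjTranspose a.1 * a.1).trace +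
      x (n + 2) * (Matrix.conjTranspose a.2 * a.2).trace = 0 := h0
    rw [add_eq_zero_iff_of_nonneg
      (mul_nonneg (h _) (Matrix.posSemidef_conjTranspose_mul_self _).trace_nonneg)
      (mul_nonneg (h _) (Matrix.posSemidef_conjTranspose_mul_self _).trace_nonneg)] at h0
    exact Prod.ext
      (Matrix.trace_conjTranspose_mul_self_eq_zero_iff.1 ((mul_eq_zero.1 h0.1).resolve_left (hne _)))
      (Matrix.trace_conjTranspose_mul_self_eq_zero_iff.1 ((mul_eq_zero.1 h0.2).resolve_left (hne _)))

theorem norm_fst_le (n : ℕ) (a : Stage r (n + 1)) :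
    ‖(a.1 : Matrix (Fin (q r (n + 1))) (Fin (q r (n + 1))) ℂ)‖ ≤ ‖a‖ :=
  _root_.norm_fst_le (E := Matrix (Fin (q r (n + 1))) (Fin (q r (n + 1))) ℂ)
    (F := Matrix (Fin (q r n)) (Fin (q r n)) ℂ) a

theorem norm_snd_le (n : ℕ) (a : Stage r (n + 1)) :
    ‖(a.2 : Matrix (Fin (q r n)) (Fin (q r n)) ℂ)‖ ≤ ‖a‖ :=
  _root_.norm_snd_le (E := Matrix (Fin (q r (n + 1))) (Fin (q r (n + 1))) ℂ)
    (F := Matrix (Fin (q r n)) (Fin (q r n)) ℂ) a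

theorem norm_stageTrace_sub_le {x' : ℕ → ℝ} (n : ℕ) (a : Stage r (n + 1)) :
    ‖stageTrace r x (n + 1) a - stageTrace r x' (n + 1) a‖ ≤
      (|x (n + 1) - x' (n + 1)| * q r (n + 1) + |x (n + 2) - x' (n + 2)| * q r n) * ‖a‖ := by
  rw [stageTrace_succ_apply, stageTrace_succ_apply]
  have e : (x (n + 1) : ℂ) * a.1.trace + x (n + 2) * a.2.trace -
      (x' (n + 1) * a.1.trace + x' (n + 2) * a.2.trace) =
      ((x (n + 1) - x' (n + 1) : ℝ) : ℂ) * a.1.trace +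
      ((x (n + 2) - x' (n + 2) : ℝ) : ℂ) * a.2.trace := by
    push_cast
    ring
  rw [e, add_mul, mul_assoc, mul_assoc]
  refine (norm_add_le _ _).trans (add_le_add ?_ ?_) <;>
  rw [norm_mul, Complex.norm_real, Real.norm_eq_abs] <;>
  refine mul_le_mul_of_nonneg_left ((norm_trace_le _).trans ?_) (abs_nonneg _)
  · exact mul_le_mul_of_nonneg_left (norm_fst_le n a) (Nat.cast_nonneg _)
  · exact mul_le_mul_of_nonneg_left (norm_snd_le n a) (Nat.cast_nonneg _)

theorem IsTraceWeight.norm_stageTrace_le (hx : IsTraceWeight r x) (n : ℕ) (a : Stage r n) :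
    ‖stageTrace r x n a‖ ≤ ‖a‖ := by
  cases n with
  | zero => exact le_rfl
  | succ n =>
    -- Comparison with zero weights gives the norm bound, whose constant is exactly the
    -- normalisation `q_mul_add`.
    have h := norm_stageTrace_sub_le (x := x) (x' := 0) n a
    have e : stageTrace r 0 (n + 1) a = 0 := by
      rw [stageTrace_succ_apply]
      simp
    rw [e, sub_zero, Pi.zero_apply, Pi.zero_apply, sub_zero, sub_zero, abs_of_nonneg (hx.nonneg _),
      abs_of_nonneg (hx.nonneg _), mul_comm (x _), mul_comm (x _), hx.q_mul_add, one_mul] at h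
    exact h

end EffrosShen

/-! ### Tracial states on the limit from compatible traces on the stages -/

namespace CStarInductiveSequence

open scoped ComplexOrder

variable (S : CStarInductiveSequence)

theorem apply_transition_eq {τ : ∀ n, S.obj n →ₗ[ℂ] ℂ}
    (hmap : ∀ n x, τ (n + 1) (S.map n x) = τ n x) {m n : ℕ} (h : m ≤ n) (x : S.obj m) :
    τ n (S.transition m n h x) = τ m x := by
  induction n, h using Nat.le_induction with
  | base => rw [transition_self]; rfl
  | succ n h ih =>
    rw [transition_succ S h]
    exact (hmap n _).trans ih

theorem exists_apply_of_eq {τ : ∀ n, S.obj n →ₗ[ℂ] ℂ}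
    (hmap : ∀ n x, τ (n + 1) (S.map n x) = τ n x) (hnorm : ∀ n x, ‖τ n x‖ ≤ ‖x‖) :
    ∃ μ : WeakDual ℂ S.Limit, ∀ n x, μ (Limit.of S n x) = τ n x := by
  let g : S.PreLimit → ℂ := DirectLimit.lift S.transition (fun n x => τ n x)
    fun _ _ h x => (S.apply_transition_eq hmap h x).symm
  have hg (n : ℕ) (x : S.obj n) : g (PreLimit.of S n x) = τ n x := rfl
  let f : S.PreLimit →ₗ[ℂ] ℂ :=
    { toFun := g
      map_add' := fun z w => by
        obtain ⟨n, x, y, rfl, rfl⟩ := PreLimit.exists_of₂ S z w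
        rw [← map_add, hg, hg, hg, map_add]
      map_smul' := fun c z => by
        obtain ⟨n, x, rfl⟩ := PreLimit.exists_of S z
        rw [← map_smul, hg, hg, map_smul, RingHom.id_apply] }
  have hf (z : S.PreLimit) : ‖f z‖ ≤ 1 * ‖z‖ := by
    obtain ⟨n, x, rfl⟩ := PreLimit.exists_of S z
    rw [one_mul]
    exact hnorm n x
  let i : S.PreLimit →L[ℂ] S.Limit :=
    ⟨⟨⟨Limit.incl S, Limit.incl_add S⟩, Limit.incl_smul S⟩, Limit.continuous_incl S⟩
  have hi : Isometry i := AddMonoidHomClass.isometry_of_norm i (Limit.norm_incl S)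
  refine ⟨StrongDual.toWeakDual ((f.mkContinuous 1 hf).extend i), fun n x => ?_⟩
  exact (f.mkContinuous 1 hf).extend_eq (e := i) (Limit.denseRange_incl S) hi.isUniformInducing
    (PreLimit.of S n x)

theorem exists_isTracialState {τ : ∀ n, S.obj n →ₗ[ℂ] ℂ}
    (hmap : ∀ n x, τ (n + 1) (S.map n x) = τ n x) (hnorm : ∀ n x, ‖τ n x‖ ≤ ‖x‖)
    (hone : ∀ n, τ n 1 = 1) (hcomm : ∀ n x y, τ n (x * y) = τ n (y * x))
    (hnonneg : ∀ n x, 0 ≤ τ n (star x * x)) : ∃ μ : WeakDual ℂ S.Limit, IsTracialState μ := by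
  obtain ⟨μ, hμ⟩ := S.exists_apply_of_eq hmap hnorm
  have hc : Continuous fun a => μ a := (WeakDual.toStrongDual μ).continuous
  refine ⟨μ, ⟨?_, fun a => ?_⟩, fun a b => ?_⟩
  · rw [← map_one (Limit.of S 0), hμ, hone]
  · refine (Limit.denseRange_incl S).induction_on (p := fun a => 0 ≤ μ (star a * a)) a
      (isClosed_le continuous_const (hc.comp (continuous_star.mul continuous_id))) fun z => ?_
    obtain ⟨n, x, rfl⟩ := PreLimit.exists_of S z
    change 0 ≤ μ (star (Limit.of S n x) * Limit.of S n x)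
    rw [← map_star, ← map_mul (Limit.of S n), hμ]
    exact hnonneg n x
  · refine (Limit.denseRange_incl S).induction_on₂ (p := fun a b => μ (a * b) = μ (b * a))
      (isClosed_eq (hc.comp continuous_mul) (hc.comp (continuous_snd.mul continuous_fst)))
      (fun z w => ?_) a b
    obtain ⟨n, x, y, rfl, rfl⟩ := PreLimit.exists_of₂ S z w
    change μ (Limit.of S n x * Limit.of S n y) = μ (Limit.of S n y * Limit.of S n x)
    rw [← map_mul (Limit.of S n), hμ, ← map_mul (Limit.of S n), hμ, hcomm]

end CStarInductiveSequence

/-! ### Tracial states of the Effros–Shen algebras and their weights -/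

namespace EffrosShen

open scoped Matrix.Norms.L2Operator ComplexOrder

/-- Traciality makes `τ` a multiple of the trace on each summand; positivity at a minimal projection
makes the multiple a nonnegative real. -/
theorem exists_eq_weightedTrace {p s : ℕ} (hp : 0 < p) (hs : 0 < s)
    (τ : (Matrix (Fin p) (Fin p) ℂ × Matrix (Fin s) (Fin s) ℂ) →ₗ[ℂ] ℂ)
    (hcomm : ∀ a b, τ (a * b) = τ (b * a)) (hnonneg : ∀ a, 0 ≤ τ (star a * a)) :
    ∃ u v : ℝ, 0 ≤ u ∧ 0 ≤ v ∧ τ = weightedTrace p s u v := by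
  let i : Fin p := ⟨0, hp⟩
  let j : Fin s := ⟨0, hs⟩
  have hu : 0 ≤ τ (Matrix.single i i 1, 0) := by
    have := hnonneg (Matrix.single i i 1, 0)
    rwa [Prod.star_def, Prod.mk_mul_mk, Matrix.star_eq_conjTranspose, Matrix.conjTranspose_single,
      Matrix.single_mul_single_same, star_one, one_mul, mul_zero] at this
  have hv : 0 ≤ τ (0, Matrix.single j j 1) := by
    have := hnonneg (0, Matrix.single j j 1)
    rwa [Prod.star_def, Prod.mk_mul_mk, Matrix.star_eq_conjTranspose (Matrix.single j j 1),
      Matrix.conjTranspose_single, Matrix.single_mul_single_same, star_one, one_mul, mul_zero] at this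
  have h₁ := eq_mul_trace (τ ∘ₗ LinearMap.inl ℂ _ _) (fun a b => by
    have := hcomm (a, 0) (b, 0)
    rwa [Prod.mk_mul_mk, Prod.mk_mul_mk, mul_zero] at this) i
  have h₂ := eq_mul_trace (τ ∘ₗ LinearMap.inr ℂ _ _) (fun a b => by
    have := hcomm (0, a) (0, b)
    rwa [Prod.mk_mul_mk, Prod.mk_mul_mk, mul_zero] at this) j
  simp only [LinearMap.comp_apply, LinearMap.inl_apply, LinearMap.inr_apply] at h₁ h₂
  refine ⟨(τ (Matrix.single i i 1, 0)).re, (τ (0, Matrix.single j j 1)).re,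
    (Complex.nonneg_iff.1 hu).1, (Complex.nonneg_iff.1 hv).1, LinearMap.ext fun a => ?_⟩
  have e : a = (a.1, 0) + (0, a.2) := by simp
  change _ = ((τ (Matrix.single i i 1, 0)).re : ℂ) * a.1.trace +
    ((τ (0, Matrix.single j j 1)).re : ℂ) * a.2.trace
  rw [← Complex.eq_re_of_ofReal_le (r := 0) (by exact_mod_cast hu),
    ← Complex.eq_re_of_ofReal_le (r := 0) (by exact_mod_cast hv), ← h₁, ← h₂, ← map_add, ← e]

theorem weightedTrace_injective {p s : ℕ} (hp : 0 < p) (hs : 0 < s) {u v u' v' : ℝ}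
    (h : weightedTrace p s u v = weightedTrace p s u' v') : u = u' ∧ v = v' := by
  have hw (u v : ℝ) (a b) : weightedTrace p s u v (a, b) = u * a.trace + v * b.trace := rfl
  have h₁ := LinearMap.congr_fun h (Matrix.single ⟨0, hp⟩ ⟨0, hp⟩ 1, 0)
  have h₂ := LinearMap.congr_fun h (0, Matrix.single ⟨0, hs⟩ ⟨0, hs⟩ 1)
  rw [hw, hw, Matrix.trace_single_eq_same, Matrix.trace_zero, mul_zero, mul_zero, add_zero, add_zero,
    mul_one, mul_one] at h₁
  rw [hw, hw, Matrix.trace_single_eq_same, Matrix.trace_zero, mul_zero, mul_zero, zero_add, zero_add,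
    mul_one, mul_one] at h₂
  exact ⟨by exact_mod_cast h₁, by exact_mod_cast h₂⟩

variable {r : ℕ → ℕ}

/-- On stage `n + 1` the state has weights `u n` and `v n`. Compatibility with the connecting map
gives `u (n + 1) = v n` and `u n = r (n + 2) * u (n + 1) + v (n + 1)`, so one sequence records all
of them. -/
theorem exists_isTraceWeight_of_isTracialState (hr : ∀ n, 1 ≤ r (n + 1))
    {μ : WeakDual ℂ (sequence r).Limit} (hμ : IsTracialState μ) :
    ∃ x, IsTraceWeight r x ∧
      ∀ n a, μ (CStarInductiveSequence.Limit.of (sequence r) n a) = stageTrace r x n a := by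
  have hq (n : ℕ) : 0 < q r n := (le_q r hr n).2
  let τ (n : ℕ) : (Matrix (Fin (q r (n + 1))) (Fin (q r (n + 1))) ℂ ×
      Matrix (Fin (q r n)) (Fin (q r n)) ℂ) →ₗ[ℂ] ℂ :=
    { toFun := fun a => μ (CStarInductiveSequence.Limit.of (sequence r) (n + 1) a)
      map_add' := fun a b => (congrArg μ (map_add
        (CStarInductiveSequence.Limit.of (sequence r) (n + 1)) a b)).trans (map_add μ _ _)
      map_smul' := fun c a => (congrArg μ (map_smul
        (CStarInductiveSequence.Limit.of (sequence r) (n + 1)) c a)).trans (map_smul μ _ _) }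
  have hcomm (n : ℕ) (a b : (sequence r).obj n) :
      μ (CStarInductiveSequence.Limit.of (sequence r) n (a * b)) =
        μ (CStarInductiveSequence.Limit.of (sequence r) n (b * a)) := by
    rw [map_mul (CStarInductiveSequence.Limit.of (sequence r) n), hμ.2,
      ← map_mul (CStarInductiveSequence.Limit.of (sequence r) n)]
  have hnonneg (n : ℕ) (a : (sequence r).obj n) :
      0 ≤ μ (CStarInductiveSequence.Limit.of (sequence r) n (star a * a)) := by
    rw [map_mul (CStarInductiveSequence.Limit.of (sequence r) n), map_star]
    exact hμ.1.2 _
  choose u v hu hv huv using fun n => exists_eq_weightedTrace (hq (n + 1)) (hq n) (τ n)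
    (hcomm (n + 1)) (hnonneg (n + 1))
  have happ (n : ℕ) (a) : μ (CStarInductiveSequence.Limit.of (sequence r) (n + 1) a) =
      weightedTrace _ _ (u n) (v n) a :=
    LinearMap.congr_fun (huv n) a
  have hrec (n : ℕ) : r (n + 2) * u (n + 1) + v (n + 1) = u n ∧ u (n + 1) = v n := by
    refine weightedTrace_injective (hq (n + 1)) (hq n) (LinearMap.ext fun a => ?_)
    refine Eq.trans ?_ (happ n a)
    refine Eq.trans ?_ (congrArg μ (CStarInductiveSequence.Limit.of_map (sequence r) (n + 1) a))
    refine Eq.trans ?_ (happ (n + 1) ((sequence r).map (n + 1) a)).symm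
    change ((r (n + 2) * u (n + 1) + v (n + 1) : ℝ) : ℂ) * a.1.trace + u (n + 1) * a.2.trace =
      (u (n + 1) : ℂ) * (blockMatrix (r (n + 2)) a.1 a.2).trace + v (n + 1) * a.1.trace
    rw [trace_blockMatrix]
    push_cast
    ring
  -- The leading 1 shifts the index; the recursion at 0 is then the value of the state at the unit
  -- of stage 1, where `q r 1 = r 1` and `q r 0 = 1`.
  let x : ℕ → ℝ := fun n => Nat.casesOn n 1 u
  have hx : IsTraceWeight r x := by
    refine ⟨rfl, fun n => ?_, fun n => ?_⟩
    · cases n with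
      | zero => exact zero_le_one
      | succ n => exact hu n
    · cases n with
      | zero =>
        have h := happ 0 1
        have e : μ (CStarInductiveSequence.Limit.of (sequence r) (0 + 1) 1) = 1 := by
          rw [map_one, hμ.1.1]
        have h := e.symm.trans h
        change (1 : ℂ) = u 0 * (1 : Matrix (Fin (q r 1)) (Fin (q r 1)) ℂ).trace +
          v 0 * (1 : Matrix (Fin (q r 0)) (Fin (q r 0)) ℂ).trace at h
        rw [Matrix.trace_one, Matrix.trace_one, Fintype.card_fin, Fintype.card_fin] at h
        have h₁ : q r 1 = r 1 := rfl
        have h₀ : q r 0 = 1 := rfl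
        rw [h₀, h₁] at h
        change (1 : ℝ) = r 1 * u 0 + u 1
        rw [(hrec 0).2, mul_comm]
        rw [Nat.cast_one, mul_one] at h
        exact_mod_cast h
      | succ n =>
        change u n = r (n + 2) * u (n + 1) + u (n + 2)
        rw [(hrec (n + 1)).2, (hrec n).1]
  refine ⟨x, hx, fun n a => ?_⟩
  cases n with
  | zero =>
    have h : (CStarInductiveSequence.Limit.of (sequence r) 0 a) =
        algebraMap ℂ (sequence r).Limit (show ℂ from a) :=
      AlgHomClass.commutes (CStarInductiveSequence.Limit.of (sequence r) 0) (show ℂ from a)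
    rw [h, apply_algebraMap_of_mem_stateSpace hμ.1]
    rfl
  | succ n =>
    refine (happ n a).trans ?_
    rw [← (hrec n).2]
    rfl

theorem exists_isTracialState_sequence (hr : ∀ n, 1 ≤ r (n + 1)) :
    ∃ μ : WeakDual ℂ (sequence r).Limit, IsTracialState μ := by
  obtain ⟨x, hx⟩ := exists_isTraceWeight r hr
  exact (sequence r).exists_isTracialState (τ := stageTrace r x) hx.stageTrace_map
    hx.norm_stageTrace_le hx.stageTrace_one stageTrace_mul_comm
    (stageTrace_star_mul_self_nonneg hx.nonneg)

theorem isFaithfulTrace (hr : ∀ n, 1 ≤ r (n + 1)) {μ : WeakDual ℂ (sequence r).Limit}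
    (hμ : IsTracialState μ) : (sequence r).IsFaithfulTrace μ := by
  obtain ⟨x, hx, h⟩ := exists_isTraceWeight_of_isTracialState hr hμ
  exact ⟨hμ, fun n a ha => eq_zero_of_stageTrace_star_mul_self (hx.pos hr) n a
    ((h n (star a * a)).symm.trans ha)⟩

end EffrosShen

/-- An index where `E n` is the identity contributes 0 whatever its weight. On a finite stage this
discards the later weights, where the dimensions of the two sequences may differ. -/
theorem towerSeminorm_congr {A : Type*} [CStarAlgebra A] {E : ℕ → A →L[ℂ] A} {β β' : ℕ → ℝ}
    (h : ∀ n, (∀ a, E n a = a) ∨ β n = β' n) : towerSeminorm E β = towerSeminorm E β' := by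
  funext a
  refine iSup_congr fun n => ?_
  rcases h n with h | h
  · rw [h, sub_self, norm_zero, zero_div, zero_div]
  · rw [h]

/-! ### Comparison of two digit sequences with a common beginning -/

namespace EffrosShen

open scoped Matrix.Norms.L2Operator

variable {r r' : ℕ → ℕ}

theorem exists_eq_algebraMap (r : ℕ → ℕ) (x : (sequence r).obj 0) :
    ∃ c, x = algebraMap ℂ ((sequence r).obj 0) c := ⟨x, rfl⟩

theorem finrank_succ (r : ℕ → ℕ) (n : ℕ) : Module.finrank ℂ ((sequence r).obj (n + 1)) =
    q r (n + 1) * q r (n + 1) + q r n * q r n := by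
  have h : Module.finrank ℂ (Matrix (Fin (q r (n + 1))) (Fin (q r (n + 1))) ℂ ×
      Matrix (Fin (q r n)) (Fin (q r n)) ℂ) = q r (n + 1) * q r (n + 1) + q r n * q r n := by
    rw [Module.finrank_prod, Module.finrank_matrix, Module.finrank_matrix]
    simp
  exact h

theorem finrank_zero (r : ℕ → ℕ) : Module.finrank ℂ ((sequence r).obj 0) = 1 :=
  Module.finrank_self ℂ

theorem le_finrank (hr : ∀ n, 1 ≤ r (n + 1)) (n : ℕ) :
    n ≤ Module.finrank ℂ ((sequence r).obj n) ∧ 0 < Module.finrank ℂ ((sequence r).obj n) := by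
  cases n with
  | zero =>
    rw [finrank_zero]
    exact ⟨zero_le_one, one_pos⟩
  | succ n =>
    rw [finrank_succ]
    obtain ⟨h₁, h₂⟩ := le_q r hr (n + 1)
    constructor <;> nlinarith

theorem dimWeight_pos (hr : ∀ n, 1 ≤ r (n + 1)) (k : ℝ) (n : ℕ) :
    0 < (sequence r).dimWeight k n :=
  one_div_pos.2 (Real.rpow_pos_of_pos (by exact_mod_cast (le_finrank hr n).2) k)

theorem tendsto_dimWeight (hr : ∀ n, 1 ≤ r (n + 1)) {k : ℝ} (hk : 0 < k) :
    Tendsto ((sequence r).dimWeight k) atTop (𝓝 0) := by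
  have h₁ : Tendsto (fun n => (Module.finrank ℂ ((sequence r).obj n) : ℝ)) atTop atTop :=
    tendsto_atTop_mono (fun n => by exact_mod_cast (le_finrank hr n).1) tendsto_natCast_atTop_atTop
  have h₂ := ((tendsto_rpow_atTop hk).comp h₁).inv_tendsto_atTop
  refine h₂.congr fun n => ?_
  exact (one_div _).symm

theorem dimWeight_congr {n : ℕ} (h : ∀ i ≤ n, r i = r' i) (k : ℝ) :
    (sequence r).dimWeight k n = (sequence r').dimWeight k n := by
  unfold CStarInductiveSequence.dimWeight
  cases n with
  | zero => rw [finrank_zero, finrank_zero]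
  | succ n => rw [finrank_succ, finrank_succ, q_congr h, q_congr fun i hi => h i (by omega)]

theorem isFaithfulTrace_epsilon (hr : ∀ n, 1 ≤ r (n + 1)) :
    (sequence r).IsFaithfulTrace (Classical.epsilon IsTracialState) :=
  isFaithfulTrace hr (Classical.epsilon_spec (exists_isTracialState_sequence hr))

theorem isQuantumCompactMetricSpace (hr : ∀ n, 1 ≤ r (n + 1)) {k : ℝ} (hk : 0 < k) :
    IsQuantumCompactMetricSpace 2 0 ((sequence r).lipNorm (Classical.epsilon IsTracialState)
      ((sequence r).dimWeight k)) := by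
  have hμ := isFaithfulTrace_epsilon hr
  have := hμ.nontrivial
  exact (hμ.isExpectationTower (exists_eq_algebraMap r)).isQuantumCompactMetricSpace
    (dimWeight_pos hr k) (tendsto_dimWeight hr hk)

/-- The identification of matrix algebras of equal sizes. -/
def pairCongr : {p p' s s' : ℕ} → p = p' → s = s' →
    (Matrix (Fin p) (Fin p) ℂ × Matrix (Fin s) (Fin s) ℂ) →⋆ₐ[ℂ]
      (Matrix (Fin p') (Fin p') ℂ × Matrix (Fin s') (Fin s') ℂ)
  | _, _, _, _, rfl, rfl => StarAlgHom.id ℂ _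

theorem pairCongr_symm_apply {p p' s s' : ℕ} (hp : p = p') (hs : s = s') (x) :
    pairCongr hp.symm hs.symm (pairCongr hp hs x) = x := by
  subst hp hs
  rfl

/-- All sizes are free variables here, so the equalities can be substituted away; this is impossible
for the values of `q`. -/
theorem pairCongr_blockHom {m m' p p' s s' : ℕ} (hm : m = m') (hp : p = p') (hs : s = s')
    (h : m * p + s = m' * p' + s') (x) :
    pairCongr h hp (blockHom m p s x) = blockHom m' p' s' (pairCongr hp hs x) := by
  subst hm hp hs
  rfl

/-- The identification of the stages of two sequences with the same digits. -/
def stageHom (r r' : ℕ → ℕ) : (n : ℕ) → (∀ i ≤ n, r i = r' i) →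
    (sequence r).obj n →⋆ₐ[ℂ] (sequence r').obj n
  | 0, _ => StarAlgHom.id ℂ ℂ
  | n + 1, h => pairCongr (q_congr h) (q_congr fun i hi => h i (hi.trans n.le_succ))

theorem stageHom_symm_apply (n : ℕ) (h : ∀ i ≤ n, r i = r' i) (x) :
    stageHom r' r n (fun i hi => (h i hi).symm) (stageHom r r' n h x) = x := by
  cases n with
  | zero => rfl
  | succ n => exact pairCongr_symm_apply (q_congr h) (q_congr fun i hi => h i (hi.trans n.le_succ)) x

theorem stageHom_map (n : ℕ) (h : ∀ i ≤ n + 1, r i = r' i) (x) :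
    stageHom r r' (n + 1) h ((sequence r).map n x) =
      (sequence r').map n (stageHom r r' n (fun i hi => h i (hi.trans n.le_succ)) x) := by
  cases n with
  | zero => exact AlgHomClass.commutes (stageHom r r' 1 h) (show ℂ from x)
  | succ n =>
    exact pairCongr_blockHom (h (n + 2) le_rfl) (q_congr fun i hi => h i (hi.trans (n + 1).le_succ))
      (q_congr fun i hi => h i (by omega)) (q_congr h) x

theorem stageHom_transition {m n : ℕ} (hmn : m ≤ n) (h : ∀ i ≤ n, r i = r' i) (x) :
    stageHom r r' n h ((sequence r).transition m n hmn x) =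
      (sequence r').transition m n hmn (stageHom r r' m (fun i hi => h i (hi.trans hmn)) x) := by
  induction n, hmn using Nat.le_induction with
  | base =>
    rw [CStarInductiveSequence.transition_self, CStarInductiveSequence.transition_self]
    rfl
  | succ n hmn ih =>
    rw [CStarInductiveSequence.transition_succ _ hmn, CStarInductiveSequence.transition_succ _ hmn]
    exact (stageHom_map n h _).trans (congrArg ((sequence r').map n)
      (ih fun i hi => h i (hi.trans n.le_succ)))

theorem weightedTrace_pairCongr {p p' s s' : ℕ} (hp : p = p') (hs : s = s') (u v : ℝ) (x) :
    weightedTrace p' s' u v (pairCongr hp hs x) = weightedTrace p s u v x := by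
  subst hp hs
  rfl

theorem stageTrace_stageHom (y : ℕ → ℝ) (n : ℕ) (h : ∀ i ≤ n, r i = r' i) (a) :
    stageTrace r' y n (stageHom r r' n h a) = stageTrace r y n a := by
  cases n with
  | zero => rfl
  | succ n => exact weightedTrace_pairCongr _ _ _ _ a

/-- Traces of sequences with many common digits are close on a fixed stage. -/
theorem norm_trace_sub_trace_le (hr : ∀ n, 1 ≤ r (n + 1)) (hr' : ∀ n, 1 ≤ r' (n + 1))
    {μ : WeakDual ℂ (sequence r).Limit} (hμ : IsTracialState μ)
    {μ' : WeakDual ℂ (sequence r').Limit} (hμ' : IsTracialState μ') {M K : ℕ} (hMK : M ≤ K)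
    (h : ∀ i ≤ K + 1, r i = r' i) (a : (sequence r).obj (M + 1)) :
    ‖μ (CStarInductiveSequence.Limit.of (sequence r) (M + 1) a) -
      μ' (CStarInductiveSequence.Limit.of (sequence r') (M + 1)
        (stageHom r r' (M + 1) (fun i hi => h i (hi.trans (Nat.succ_le_succ hMK))) a))‖ ≤
      2 * q r M * q r (M + 1) / (K + 1) * ‖a‖ := by
  obtain ⟨x, hx, hμx⟩ := exists_isTraceWeight_of_isTracialState hr hμ
  obtain ⟨x', hx', hμx'⟩ := exists_isTraceWeight_of_isTracialState hr' hμ'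
  have h₁ := hx.abs_sub_le hx' hr hr' h (n := M) (by omega)
  have h₂ := hx.abs_sub_le hx' hr hr' h (n := M + 1) (by omega)
  rw [hμx, hμx', stageTrace_stageHom]
  refine (norm_stageTrace_sub_le M a).trans (mul_le_mul_of_nonneg_right ?_ (norm_nonneg _))
  calc _ ≤ q r M / (K + 1) * q r (M + 1) + q r (M + 1) / (K + 1) * (q r M : ℝ) := by gcongr
    _ = _ := by ring

/-- The quantum compact metric space of a sequence of digits. -/
noncomputable def space (r : ℕ → ℕ) (hr : ∀ n, 1 ≤ r (n + 1)) (k : ℝ) (hk : 0 < k) :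
    QuantumCompactMetricSpace 2 0 where
  carrier := (sequence r).Limit
  lip := (sequence r).lipNorm (Classical.epsilon IsTracialState) ((sequence r).dimWeight k)
  isQuantumCompactMetricSpace := isQuantumCompactMetricSpace hr hk

/-- The three terms are the three bridges through the two copies of stage `M + 1`. The constants
that determine `K` depend on `r`, `k`, `M` and `ε` only, so `K` is uniform in `r'`. -/
theorem exists_edist_space_le (hr : ∀ n, 1 ≤ r (n + 1)) {k : ℝ} (hk : 0 < k) (M : ℕ) {ε : ℝ}
    (hε : 0 < ε) : ∃ K, ∀ r' (hr' : ∀ n, 1 ≤ r' (n + 1)), (∀ i ≤ K, r i = r' i) →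
      edist (space r hr k hk) (space r' hr' k hk) ≤
        ENNReal.ofReal ((sequence r).dimWeight k (M + 1)) + ENNReal.ofReal ε +
          ENNReal.ofReal ((sequence r).dimWeight k (M + 1)) := by
  set β := (sequence r).dimWeight k with hβdef
  have hβ := dimWeight_pos hr k
  have hμ := isFaithfulTrace_epsilon hr
  obtain ⟨c, hc, hcμ⟩ := hμ.exists_le_apply_star_mul_self (M + 1)
  -- The tolerance `κ * β n` has to be met only for `n ≤ M`, since both restricted expectations are
  -- the identity from `M + 1` on; the smallest such weight is the strictest.
  obtain ⟨n₀, -, hn₀⟩ := Finset.exists_min_image (Finset.range (M + 1)) β ⟨0, by simp⟩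
  have hb := hβ n₀
  have hβ0 := hβ 0
  rw [← hβdef] at hb hβ0 hβ
  -- Chosen so that the length `β 0 * (κ * β 0)` of the middle bridge is `ε`.
  set κ : ℝ := ε / (β 0 * β 0) with hκ
  have hκ0 : 0 < κ := by positivity
  -- The first summand makes `2 * δ / c ≤ κ * β n₀` for the trace discrepancy `δ` below; the extra
  -- `M` ensures `M ≤ K`.
  obtain ⟨K, hK⟩ := exists_nat_ge (2 * (2 * q r M * q r (M + 1)) / (c * κ * β n₀) + M)
  refine ⟨K + 1, fun r' hr' hrr' => ?_⟩
  have hMK : M ≤ K := by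
    have : (M : ℝ) ≤ K := le_trans (le_add_of_nonneg_left (by positivity)) hK
    exact_mod_cast this
  have hagree : ∀ i ≤ M + 1, r i = r' i := fun i hi => hrr' i (by omega)
  have hμ' := isFaithfulTrace_epsilon hr'
  have hβ' := dimWeight_pos hr' k
  obtain ⟨E, hE⟩ := hμ.exists_isRestriction (M + 1)
  obtain ⟨E', hE'⟩ := hμ'.exists_isRestriction (M + 1)
  have hT := hE.isExpectationTower hμ (exists_eq_algebraMap r)
  have hT' := hE'.isExpectationTower hμ' (exists_eq_algebraMap r')
  obtain ⟨γ₁, hγ₁⟩ := hE.exists_bridge_length_le hμ (exists_eq_algebraMap r) hβ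
  obtain ⟨γ₃, hγ₃⟩ := hE'.exists_bridge_length_le hμ' (exists_eq_algebraMap r') hβ'
  rw [← dimWeight_congr hagree] at hγ₃
  let e := stageHom r r' (M + 1) hagree
  let f := stageHom r' r (M + 1) fun i hi => (hagree i hi).symm
  have hfe (b) : f (e b) = b := stageHom_symm_apply (M + 1) hagree b
  have hef (b) : e (f b) = b :=
    stageHom_symm_apply (r := r') (r' := r) (M + 1) (fun i hi => (hagree i hi).symm) b
  have he (b) : ‖e b‖ = ‖b‖ :=
    NonUnitalStarAlgHom.norm_map e (Function.LeftInverse.injective hfe) b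
  set δ : ℝ := 2 * q r M * q r (M + 1) / (K + 1) with hδ
  have hclose (n : ℕ) (b) : ‖e (E n b) - E' n (e b)‖ ≤ 2 * δ / c * ‖b‖ :=
    hE.norm_sub_le hμ hE' hμ' hT'.norm_le he
      (fun n h x => ⟨_, stageHom_transition h hagree x⟩)
      (fun n h y => ⟨stageHom r' r n (fun i hi => (hagree i (hi.trans h)).symm) y, by
        rw [stageHom_transition h hagree]
        congr 1
        exact stageHom_symm_apply (r := r') (r' := r) n _ y⟩)
      hc (by positivity) hcμ
      (norm_trace_sub_trace_le hr hr' hμ.isTracialState hμ'.isTracialState hMK hrr') n b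
  have hδκ : 2 * δ / c ≤ κ * β n₀ := by
    have hK' : 2 * (2 * q r M * q r (M + 1)) / (c * κ * β n₀) ≤ (K : ℝ) + 1 := by
      have : (0 : ℝ) ≤ M := Nat.cast_nonneg M
      linarith
    rw [div_le_iff₀ (by positivity)] at hK'
    rw [hδ, div_le_iff₀ hc, ← mul_div_assoc, div_le_iff₀ (by positivity)]
    linarith
  obtain ⟨γ₂, hγ₂⟩ := exists_bridge_length_le_of_perturbation hT hT' hef hfe
    ⟨_, dualMap_mem_stateSpace (CStarInductiveSequence.Limit.of (sequence r') (M + 1))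
      hμ'.isTracialState.1⟩ hβ hκ0.le fun n b => by
      by_cases hn : n < M + 1
      · refine (hclose n b).trans (mul_le_mul_of_nonneg_right (hδκ.trans ?_) (norm_nonneg _))
        exact mul_le_mul_of_nonneg_left (hn₀ n (Finset.mem_range.2 hn)) hκ0.le
      · rw [hE.apply_of_le hμ (not_lt.1 hn), hE'.apply_of_le hμ' (not_lt.1 hn), sub_self, norm_zero]
        have := hβ n
        positivity
  have hlip : towerSeminorm E' β = towerSeminorm E' ((sequence r').dimWeight k) := by
    refine towerSeminorm_congr fun n => ?_
    by_cases hn : n < M + 1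
    · exact Or.inr (dimWeight_congr (fun i hi => hagree i (by omega)) k)
    · exact Or.inl fun a => hE'.apply_of_le hμ' (not_lt.1 hn) a
  have hκε : β 0 * (κ * β 0) = ε := by
    rw [hκ]
    field_simp
  rw [hlip, hκε] at hγ₂
  have hnt {s : ℕ → ℕ} {ν : WeakDual ℂ (sequence s).Limit} (hν : (sequence s).IsFaithfulTrace ν) :
      Nontrivial ((sequence s).obj (M + 1)) := by
    have := hν.nontrivial
    refine ⟨1, 0, fun h => one_ne_zero (α := (sequence s).Limit) ?_⟩
    rw [← map_one (CStarInductiveSequence.Limit.of (sequence s) (M + 1)), h, map_zero]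
  have := hnt hμ
  have := hnt hμ'
  -- A trek may only pass through spaces of the class, so the finite stages have to be quantum
  -- compact metric spaces themselves.
  let Y : QuantumCompactMetricSpace 2 0 := ⟨(sequence r).obj (M + 1), towerSeminorm E β,
    hT.isQuantumCompactMetricSpace hβ (tendsto_dimWeight hr hk)⟩
  let Y' : QuantumCompactMetricSpace 2 0 := ⟨(sequence r').obj (M + 1),
    towerSeminorm E' ((sequence r').dimWeight k),
    hT'.isQuantumCompactMetricSpace hβ' (tendsto_dimWeight hr' hk)⟩
  refine (edist_triangle4 _ Y Y' _).trans (add_le_add (add_le_add ?_ ?_) ?_)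
  · exact (quantumPropinquity_le_length (X := space r hr k hk) (Y := Y) γ₁).trans hγ₁
  · exact (quantumPropinquity_le_length (X := Y) (Y := Y') γ₂).trans hγ₂
  · rw [edist_comm]
    exact (quantumPropinquity_le_length (X := space r' hr' k hk) (Y := Y') γ₃).trans hγ₃

/-! ### Compactness of the digit set and continuity -/

/-- The sequences of digits with bounds `C` and `B`. -/
def digitSet (C B : ℕ → ℕ+) : Set (ℕ → ℕ) :=
  Set.pi Set.univ fun n => if n = 0 then {0} else Set.Icc (C n : ℕ) (B n)

theorem isCompact_digitSet (C B : ℕ → ℕ+) : IsCompact (digitSet C B) := by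
  refine isCompact_univ_pi fun n => ?_
  split_ifs
  · exact isCompact_singleton
  · exact isCompact_Icc

theorem one_le_of_mem_digitSet {C B : ℕ → ℕ+} (hr : r ∈ digitSet C B) (n : ℕ) :
    1 ≤ r (n + 1) := by
  have h := hr (n + 1) trivial
  beta_reduce at h
  rw [if_neg n.succ_ne_zero] at h
  exact (C (n + 1)).pos.trans_le h.1

theorem cfDigit_mem_digitSet {C B : ℕ → ℕ+} {θ : ℝ} (hθ : θ ∈ boundedDigits C B) :
    cfDigit θ ∈ digitSet C B := by
  intro n _
  beta_reduce
  split_ifs with h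
  · subst h
    exact Nat.floor_eq_zero.2 hθ.2.1.2
  · exact hθ.2.2 n (Nat.one_le_iff_ne_zero.2 h)

theorem exists_mem_boundedDigits {C B : ℕ → ℕ+} (hr : r ∈ digitSet C B) :
    ∃ θ ∈ boundedDigits C B, cfDigit θ = r := by
  have h0 := hr 0 trivial
  beta_reduce at h0
  rw [if_pos rfl] at h0
  obtain ⟨θ, h₁, h₂, h₃⟩ := exists_mem_Ioo_cfDigit_eq r h0 (one_le_of_mem_digitSet hr)
  refine ⟨θ, ⟨h₁, h₂, fun n hn => ?_⟩, h₃⟩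
  have h := hr n trivial
  beta_reduce at h
  rw [if_neg (Nat.one_le_iff_ne_zero.1 hn)] at h
  rw [h₃]
  exact h

/-- Agreement up to `K` is a neighbourhood in the product of discrete spaces. First `M` is taken so
large that each outer bridge costs less than `η / 3`, then `K` so that the middle one costs at most
`η / 3`. -/
theorem continuous_space (C B : ℕ → ℕ+) {k : ℝ} (hk : 0 < k) : Continuous
    fun r : digitSet C B => space r.1 (one_le_of_mem_digitSet r.2) k hk := by
  refine continuous_iff_continuousAt.2 fun r => EMetric.tendsto_nhds.2 fun ε hε => ?_
  have hr := one_le_of_mem_digitSet r.2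
  obtain ⟨η, hη0, hη⟩ := ENNReal.lt_iff_exists_nnreal_btwn.1 hε
  have hη0 : (0 : ℝ) < η := by exact_mod_cast hη0
  obtain ⟨M, hM⟩ := (((tendsto_add_atTop_iff_nat 1).2 (tendsto_dimWeight hr hk)).eventually
    (gt_mem_nhds (show (0 : ℝ) < η / 3 by positivity))).exists
  obtain ⟨K, hK⟩ := exists_edist_space_le hr hk M (show (0 : ℝ) < η / 3 by positivity)
  have hev : ∀ᶠ r' : digitSet C B in 𝓝 r, ∀ i ∈ Set.Iic K, r.1 i = r'.1 i := by
    refine (eventually_all_finite (Set.finite_Iic K)).2 fun i _ => ?_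
    have hc : Continuous fun r' : digitSet C B => r'.1 i :=
      (continuous_apply i).comp continuous_subtype_val
    exact (hc.tendsto r).eventually (p := fun j => r.1 i = j) (by
      rw [nhds_discrete]
      exact eventually_pure.2 rfl)
  filter_upwards [hev] with r' hr'
  rw [edist_comm]
  refine ((hK r'.1 (one_le_of_mem_digitSet r'.2) hr').trans ?_).trans_lt hη
  have hp := (dimWeight_pos hr k (M + 1)).le
  rw [← ENNReal.ofReal_add hp (by positivity), ← ENNReal.ofReal_add (by positivity) hp,
    ← ENNReal.ofReal_coe_nnreal]
  exact ENNReal.ofReal_le_ofReal (by linarith)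

end EffrosShen

theorem mainTheorem8 (k : ℝ) (hk : 0 < k) (C B : ℕ → ℕ+) :
    ∃ h : ∀ θ ∈ boundedDigits C B, IsQuantumCompactMetricSpace 2 0 (effrosShenLipNorm k θ),
      IsCompact {X : QuantumCompactMetricSpace 2 0 | ∃ (θ : ℝ) (hθ : θ ∈ boundedDigits C B),
        X = ⟨EffrosShenAlgebra θ, effrosShenLipNorm k θ, h θ hθ⟩} := by
  refine ⟨fun θ hθ => EffrosShen.isQuantumCompactMetricSpace
    (EffrosShen.one_le_of_mem_digitSet (EffrosShen.cfDigit_mem_digitSet hθ)) hk, ?_⟩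
  have : CompactSpace (EffrosShen.digitSet C B) :=
    isCompact_iff_compactSpace.1 (EffrosShen.isCompact_digitSet C B)
  -- The space of `θ` is by definition that of `cfDigit θ`, so both inclusions reduce to the
  -- correspondence between `boundedDigits C B` and `digitSet C B`.
  convert isCompact_range (EffrosShen.continuous_space C B hk) using 1
  ext X
  constructor
  · rintro ⟨θ, hθ, rfl⟩
    exact ⟨⟨cfDigit θ, EffrosShen.cfDigit_mem_digitSet hθ⟩, rfl⟩
  · rintro ⟨⟨r, hr⟩, rfl⟩
    obtain ⟨θ, hθ, rfl⟩ := EffrosShen.exists_mem_boundedDigits hr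
    exact ⟨θ, hθ, rfl⟩
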